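/- An arrow presentation $G$ consists of finitely many circles (its vertices, $V(G)$) with finitely many labelled arrows lying on disjoint arcs of them, each label (edge, $E(G)$) being carried by exactly two arrows. A vertex partitioned arrow presentation $(G,\mathcal V)$ is an arrow presentation with a partition $\mathcal V$ of $V(G)$; the blocks are called vertex classes. Let an edge $e$ have arrows $\overrightarrow{p_1p_2}$ and $\overrightarrow{q_1q_2}$, lying on the vertices $u$ and $v$. Then: * $G\backslash e$ (deletion) removes the two arrows, keeping the arcs and $\mathcal V$; * the merge-deletion of $e$ is $G\backslash e$ with the vertex classes of $u$ and $v$ merged; * $G/e$ (contraction) removes the arrows and the arcs under them and identifies $p_1$ with $q_2$ and $p_2$ with $q_1$, while the Penrose-contraction of $e$ identifies instead $p_1$ with $q_1$ and $p_2$ with $q_2$; in both cases the vertex classes of $u$ and $v$ are merged, and the new circles replace $u,v$ in the merged class. A packaged arrow presentation $(G,\mathcal V,\mathcal B)$ has in addition a partition $\mathcal B$ of the set of boundary components of $G$, which are the closed curves obtained from the circles by removing, for every edge as above, the arcs under its arrows and joining $q_2$ to $p_1$ and $p_2$ to $q_1$ by new curves. In deletion, merge-deletion and Penrose-contraction of $e$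 the classes of the boundary components incident to $e$ are merged (the new boundary components replacing the old ones in the merged class); in contraction $\mathcal B$ is unchanged; merge-contraction is contraction with the boundary classes at $e$ merged as well. There is a unique map $Q(G)=Q(G;a,b,c,x,y,\alpha,\beta,\gamma)\in\mathbb Z[a,b,c,x,y,\alpha,\beta,\gamma]$ on packaged arrow presentations such that, for every edge $e$, $Q(G)$ is $a,b,c,x,y$ times the values of $Q$ on the results of deletion, contraction, Penrose-contraction, merge-deletion and merge-contraction of $e$, respectively, summed up, and $Q(G)=\alpha^{|V(G)|}\beta^{|\mathcal V|}\gamma^{|\mathcal B|}$ if $G$ has no edges. For a vertex partitioned arrow presentation $G$ put $\hat Q(G;a,b,c,x,\alpha,\beta)=Q(\underline G;a,b,c,x,0,\alpha,\beta,1)$, where $\underline G$ is $G$ with any boundary partition (the value does not depend on it). A coupling $\varphi$ of an edge $f$ of $G$ with an edge $e$ of $H$ is a bijection from the two arrows of $f$ to the two arrows of $e$. The 2-sum $G\oplus_\varphi H$ is obtained from the disjoint union by removing these four arrows and the arcs under them, and identifying the tail (head) of each arrow of $f$ with the tail (head) of its image under $\varphi$; for each of the two coupled pairs of arrows, the class of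 the vertex carrying the arrow of $f$ is merged with the class of the vertex carrying its image, and each new circle belongs to the class of the circles its arcs come from. Given a fixed edge $e$ of $H$ and, for every edge $f$ of $G$, a coupling $\varphi_f$ of $f$ with $e$, the tensor product $G\otimes_{\boldsymbol\varphi}H$ is obtained from $G$ by forming, for every edge $f$ of $G$ successively (in any order), the 2-sum with a new copy of $H$ with respect to $\varphi_f$. **Theorem.** Let $G$ and $H$ be vertex partitioned arrow presentations, $e$ an edge of $H$, and for each edge $f$ of $G$ let $\varphi_f$ be a coupling of $f$ with $e$; $\boldsymbol\varphi=\{\varphi_f\}_{f\in E(G)}$. Let $a,b,c,x,\alpha,\beta$ be indeterminates (elements of a field that are algebraically independent over $\mathbb Z$). Then the linear system $$\alpha\beta\begin{pmatrix}\alpha\beta&1&1&\alpha\\1&\alpha&1&1\\1&1&\alpha&1\\\alpha&1&1&\alpha\end{pmatrix}\begin{pmatrix}\phi_{(=,2)}\\\phi_{\parallel}\\\phi_{\times}\\\phi_{(=,1)}\end{pmatrix}=\begin{pmatrix}\hat Q(H_1;a,b,c,x,\alpha,\beta)\\\hat Q(H_2;a,b,c,x,\alpha,\beta)\\\hat Q(H_3;a,b,c,x,\alpha,\beta)\\\hat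 Q(H_4;a,b,c,x,\alpha,\beta)\end{pmatrix},$$ where $H_1,H_2,H_3,H_4$ are obtained from $H$ by deletion, contraction, Penrose-contraction and merge-deletion of $e$, respectively, has a unique solution, and for it $$\hat Q(G\otimes_{\boldsymbol\varphi}H;a,b,c,x,\alpha,\beta)=\hat Q(G;\phi_{(=,2)},\phi_{\parallel},\phi_{\times},\phi_{(=,1)},\alpha,\beta).$$ -/

import Mathlib

universe u

/-!
Combinatorial arrow presentations.

Circles are cut up by finitely many points into arcs which, going round each circle, are
alternately *gaps* and *segments*.  Every circle carries at least two points.  The arrows lie on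
pairwise disjoint segments; a segment need not carry an arrow, so that circles without arrows and
plain subdivisions are covered.
-/

/-- Redefine the map `s` on the range of `k`, where it becomes the transport of `t`. -/
noncomputable def reglue {P ι : Type*} (k : ι → P) (t : ι → ι) (s : P → P) : P → P :=
  Function.extend k (k ∘ t) s

section reglue

variable {P ι : Type*} {k : ι → P} {t : ι → ι} {s : P → P}

theorem reglue_apply (hk : Function.Injective k) (a : ι) : reglue k t s (k a) = k (t a) :=
  hk.extend_apply _ _ _

theorem reglue_of_not (x : P) (hx : ∀ a, k a ≠ x) : reglue k t s x = s x :=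
  Function.extend_apply' _ _ _ (fun ⟨a, h⟩ => hx a h)

theorem reglue_reglue (hk : Function.Injective k) (ht : ∀ a, t (t a) = a)
    (hs : ∀ x, s (s x) = x) (hr : ∀ a, ∃ b, s (k a) = k b) (x : P) :
    reglue k t s (reglue k t s x) = x := by
  by_cases hx : ∃ a, k a = x
  · obtain ⟨a, rfl⟩ := hx
    rw [reglue_apply hk, reglue_apply hk, ht]
  · push Not at hx
    rw [reglue_of_not x hx, reglue_of_not, hs]
    intro a ha
    obtain ⟨b, hb⟩ := hr a
    rw [ha, hs] at hb
    exact hx b hb.symm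

theorem reglue_ne (hk : Function.Injective k) (ht : ∀ a, t a ≠ a) (hs : ∀ x, s x ≠ x) (x : P) :
    reglue k t s x ≠ x := by
  by_cases hx : ∃ a, k a = x
  · obtain ⟨a, rfl⟩ := hx
    rw [reglue_apply hk]
    exact fun h => ht a (hk h)
  · push Not at hx
    rw [reglue_of_not x hx]
    exact hs x

end reglue

/-- The partition obtained from `r` by merging the blocks of `x` and `y`. -/
def mergeBlocks {P : Type*} (r : Setoid P) (x y : P) : Setoid P :=
  r ⊔ Relation.EqvGen.setoid (fun a b => a = x ∧ b = y)

theorem le_mergeBlocks {P : Type*} (r : Setoid P) (x y : P) : r ≤ mergeBlocks r x y := le_sup_left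

theorem mergeBlocks_rel {P : Type*} (r : Setoid P) (x y : P) : mergeBlocks r x y x y :=
  (le_sup_right : _ ≤ mergeBlocks r x y) (Relation.EqvGen.rel _ _ ⟨rfl, rfl⟩)

theorem eqvGen_setoid_le {P : Type*} {r : P → P → Prop} {s : Setoid P}
    (h : ∀ x y, r x y → s x y) : Relation.EqvGen.setoid r ≤ s :=
  Setoid.eqvGen_le h

/-- An arrow presentation with point set `P` and edge set `E`.
`gap x` and `seg x` are the other ends of the gap and of the segment that end at `x`.
The edge `e` is constituted by two arrows, indexed by `Bool`; the arrow `i` runs along a segment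
from its tail `pt e (i, false)` to its head `pt e (i, true)`. -/
structure ArrowPresentation (P E : Type u) where
  gap : P → P
  gap_gap : ∀ x, gap (gap x) = x
  gap_ne : ∀ x, gap x ≠ x
  seg : P → P
  seg_seg : ∀ x, seg (seg x) = x
  seg_ne : ∀ x, seg x ≠ x
  pt : E → Bool × Bool → P
  pt_inj : ∀ e e' a a', pt e a = pt e' a' → e = e' ∧ a = a'
  seg_pt : ∀ e i j, seg (pt e (i, j)) = pt e (i, !j)

namespace ArrowPresentation

variable {P E : Type u} (G : ArrowPresentation P E)

theorem pt_injective (e : E) : Function.Injective (G.pt e) :=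
  fun a a' h => (G.pt_inj e e a a' h).2

/-- Two points are equivalent if they lie on the same circle: the classes are the vertices. -/
def circles : Setoid P :=
  Relation.EqvGen.setoid (fun x y => y = G.gap x ∨ y = G.seg x)

/-- The elementary steps along a boundary component: along gaps, along segments without an arrow,
and, for an edge with arrows `p₁p₂` and `q₁q₂`, along new curves joining `q₂` to `p₁` and `p₂` to
`q₁`. -/
def BoundaryStep (x y : P) : Prop :=
  y = G.gap x ∨ ((∀ e a, x ≠ G.pt e a) ∧ y = G.seg x) ∨
    ∃ e i j, x = G.pt e (i, j) ∧ y = G.pt e (!i, !j)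

/-- Two points are equivalent if they lie on the same boundary component. -/
def boundaries : Setoid P := Relation.EqvGen.setoid G.BoundaryStep

/-- The number of vertices. -/
noncomputable def numVertices : ℕ := Nat.card (Quotient G.circles)

theorem circles_gap (x : P) : G.circles x (G.gap x) := Relation.EqvGen.rel _ _ (Or.inl rfl)

theorem circles_seg (x : P) : G.circles x (G.seg x) := Relation.EqvGen.rel _ _ (Or.inr rfl)

theorem boundaries_pt (e : E) (i j : Bool) :
    G.boundaries (G.pt e (i, j)) (G.pt e (!i, !j)) :=
  Relation.EqvGen.rel _ _ (Or.inr (Or.inr ⟨e, i, j, rfl, rfl⟩))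

/-- Delete `e`: forget its two arrows. -/
def delete (e : E) : ArrowPresentation P {g : E // g ≠ e} where
  gap := G.gap
  gap_gap := G.gap_gap
  gap_ne := G.gap_ne
  seg := G.seg
  seg_seg := G.seg_seg
  seg_ne := G.seg_ne
  pt g := G.pt g.1
  pt_inj _ _ _ _ h := ⟨Subtype.ext (G.pt_inj _ _ _ _ h).1, (G.pt_inj _ _ _ _ h).2⟩
  seg_pt g := G.seg_pt g.1

/-- Remove the segments carrying the two arrows of `e` and reconnect their four ends as prescribed
by the fixed-point free involution `t`. -/
noncomputable def reconnect (e : E) (t : Bool × Bool → Bool × Bool)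
    (ht : ∀ a, t (t a) = a) (ht' : ∀ a, t a ≠ a) : ArrowPresentation P {g : E // g ≠ e} where
  gap := G.gap
  gap_gap := G.gap_gap
  gap_ne := G.gap_ne
  seg := reglue (G.pt e) t G.seg
  seg_seg := reglue_reglue (G.pt_injective e) ht G.seg_seg
    (fun a => ⟨(a.1, !a.2), G.seg_pt e a.1 a.2⟩)
  seg_ne := reglue_ne (G.pt_injective e) ht' G.seg_ne
  pt g := G.pt g.1
  pt_inj _ _ _ _ h := ⟨Subtype.ext (G.pt_inj _ _ _ _ h).1, (G.pt_inj _ _ _ _ h).2⟩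
  seg_pt g i j := by
    rw [reglue_of_not, G.seg_pt]
    exact fun a ha => g.2 (G.pt_inj _ _ _ _ ha).1.symm

/-- Contract `e`: for the arrows `p₁p₂` and `q₁q₂`, join `p₁` to `q₂` and `p₂` to `q₁`. -/
noncomputable def contract (e : E) : ArrowPresentation P {g : E // g ≠ e} :=
  G.reconnect e (fun a => (!a.1, !a.2)) (by simp) (by simp [Prod.ext_iff])

/-- Penrose-contract `e`: for the arrows `p₁p₂` and `q₁q₂`, join `p₁` to `q₁` and `p₂` to `q₂`. -/
noncomputable def penrose (e : E) : ArrowPresentation P {g : E // g ≠ e} :=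
  G.reconnect e (fun a => (!a.1, a.2)) (by simp) (by simp [Prod.ext_iff])

end ArrowPresentation

/-- A coupling of two edges: a bijection between their pairs of arrows. -/
abbrev Coupling : Type := Bool ≃ Bool

namespace ArrowPresentation

variable {P E P' E' : Type u}

/-- The eight arrow ends that take part in a 2-sum. -/
def sumEnds (G : ArrowPresentation P E) (f : E) (H : ArrowPresentation P' E') (e : E') :
    (Bool × Bool) ⊕ (Bool × Bool) → P ⊕ P' :=
  Sum.map (G.pt f) (H.pt e)

theorem sumEnds_injective (G : ArrowPresentation P E) (f : E) (H : ArrowPresentation P' E')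
    (e : E') : Function.Injective (sumEnds G f H e) :=
  (G.pt_injective f).sumMap (H.pt_injective e)

/-- The ends of the arrow `i` of the first edge are matched with those of the arrow `φ i` of the
second one, tail with tail and head with head. -/
def sumMatch (φ : Coupling) : (Bool × Bool) ⊕ (Bool × Bool) → (Bool × Bool) ⊕ (Bool × Bool)
  | Sum.inl a => Sum.inr (φ a.1, a.2)
  | Sum.inr a => Sum.inl (φ.symm a.1, a.2)

/-- The 2-sum: remove the four segments carrying the arrows of `f` and of `e`, and join each end of
an arrow of `f` to the corresponding end of the coupled arrow of `e`. -/
noncomputable def twoSum (G : ArrowPresentation P E) (f : E) (H : ArrowPresentation P' E')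
    (e : E') (φ : Coupling) :
    ArrowPresentation (P ⊕ P') ({g : E // g ≠ f} ⊕ {g : E' // g ≠ e}) where
  gap := Sum.map G.gap H.gap
  gap_gap := by rintro (x | x) <;> simp [G.gap_gap, H.gap_gap]
  gap_ne := by rintro (x | x) <;> simp [G.gap_ne, H.gap_ne]
  seg := reglue (sumEnds G f H e) (sumMatch φ) (Sum.map G.seg H.seg)
  seg_seg := by
    refine reglue_reglue (sumEnds_injective G f H e) ?_ ?_ ?_
    · rintro (a | a) <;> simp [sumMatch]
    · rintro (x | x) <;> simp [G.seg_seg, H.seg_seg]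
    · rintro (a | a)
      · exact ⟨Sum.inl (a.1, !a.2), congrArg Sum.inl (G.seg_pt f a.1 a.2)⟩
      · exact ⟨Sum.inr (a.1, !a.2), congrArg Sum.inr (H.seg_pt e a.1 a.2)⟩
  seg_ne := by
    refine reglue_ne (sumEnds_injective G f H e) ?_ ?_
    · rintro (a | a) <;> simp [sumMatch]
    · rintro (x | x) <;> simp [G.seg_ne, H.seg_ne]
  pt := Sum.elim (fun g a => Sum.inl (G.pt g.1 a)) (fun g a => Sum.inr (H.pt g.1 a))
  pt_inj := by
    rintro (g | g) (g' | g') a a' h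
    · have := G.pt_inj _ _ _ _ (Sum.inl.inj h)
      exact ⟨congrArg Sum.inl (Subtype.ext this.1), this.2⟩
    · simp at h
    · simp at h
    · have := H.pt_inj _ _ _ _ (Sum.inr.inj h)
      exact ⟨congrArg Sum.inr (Subtype.ext this.1), this.2⟩
  seg_pt := by
    rintro (g | g) i j
    · rw [reglue_of_not]
      · exact congrArg Sum.inl (G.seg_pt g.1 i j)
      · rintro (a | a) h
        · exact g.2 (G.pt_inj _ _ _ _ (Sum.inl.inj h)).1.symm
        · simp [sumEnds] at h
    · rw [reglue_of_not]
      · exact congrArg Sum.inr (H.seg_pt g.1 i j)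
      · rintro (a | a) h
        · simp [sumEnds] at h
        · exact g.2 (H.pt_inj _ _ _ _ (Sum.inr.inj h)).1.symm

end ArrowPresentation

/-- A vertex partitioned arrow presentation.  A partition of the set of vertices is given as an
equivalence relation on points that is coarser than lying on the same vertex. -/
structure VertexPartitioned (P E : Type u) extends ArrowPresentation P E where
  vcls : Setoid P
  circles_le : toArrowPresentation.circles ≤ vcls

/-- A packaged arrow presentation: also the set of boundary components is partitioned. -/
structure Packaged (P E : Type u) extends VertexPartitioned P E where
  bcls : Setoid P
  boundaries_le : toArrowPresentation.boundaries ≤ bcls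

namespace ArrowPresentation

variable {P E : Type u} (G : ArrowPresentation P E)

theorem reconnect_circles_le (e : E) (t : Bool × Bool → Bool × Bool)
    (ht : ∀ a, t (t a) = a) (ht' : ∀ a, t a ≠ a) (r : Setoid P) (hr : G.circles ≤ r) :
    (G.reconnect e t ht ht').circles ≤
      mergeBlocks r (G.pt e (false, false)) (G.pt e (true, false)) := by
  set m := mergeBlocks r (G.pt e (false, false)) (G.pt e (true, false))
  have hm : G.circles ≤ m := hr.trans (le_mergeBlocks _ _ _)
  have key : ∀ a, m (G.pt e (false, false)) (G.pt e a) := by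
    have h1 : m (G.pt e (false, false)) (G.pt e (true, false)) := mergeBlocks_rel _ _ _
    have h2 : ∀ i, m (G.pt e (i, false)) (G.pt e (i, true)) := fun i => by
      have := hm (G.circles_seg (G.pt e (i, false)))
      rwa [G.seg_pt] at this
    rintro ⟨_ | _, _ | _⟩
    · exact m.refl _
    · exact h2 false
    · exact h1
    · exact m.trans h1 (h2 true)
  apply eqvGen_setoid_le
  rintro x y (rfl | rfl)
  · exact hm (G.circles_gap x)
  · by_cases hx : ∃ a, G.pt e a = x
    · obtain ⟨a, rfl⟩ := hx
      change m _ (reglue (G.pt e) t G.seg (G.pt e a))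
      rw [reglue_apply (G.pt_injective e)]
      exact m.trans (m.symm (key a)) (key (t a))
    · push Not at hx
      change m _ (reglue (G.pt e) t G.seg x)
      rw [reglue_of_not x hx]
      exact hm (G.circles_seg x)

/-- A step in a presentation in which the segments at the ends of `e` have been changed. -/
theorem boundaries_le_of_step {e : E}
    {K : ArrowPresentation P {g : E // g ≠ e}} {m : Setoid P}
    (hgap : K.gap = G.gap) (hpt : ∀ g, K.pt g = G.pt g.1)
    (hseg : ∀ x, (∀ a, G.pt e a ≠ x) → K.seg x = G.seg x)
    (hm : G.boundaries ≤ m) (he : ∀ a, m (G.pt e a) (K.seg (G.pt e a))) :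
    K.boundaries ≤ m := by
  apply eqvGen_setoid_le
  rintro x y (rfl | ⟨hx, rfl⟩ | ⟨g, i, j, rfl, rfl⟩)
  · rw [hgap]
    exact hm (Relation.EqvGen.rel _ _ (Or.inl rfl))
  · by_cases h : ∃ a, G.pt e a = x
    · obtain ⟨a, rfl⟩ := h
      exact he a
    · push Not at h
      rw [hseg x h]
      refine hm (Relation.EqvGen.rel _ _ (Or.inr (Or.inl ⟨?_, rfl⟩)))
      intro g a hga
      by_cases hg : g = e
      · subst hg
        exact h a hga.symm
      · refine hx ⟨g, hg⟩ a ?_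
        rw [hpt]
        exact hga
  · rw [hpt]
    exact hm (G.boundaries_pt g.1 i j)

theorem merge_ends (e : E) (r : Setoid P) (hr : G.boundaries ≤ r) (a a' : Bool × Bool) :
    mergeBlocks r (G.pt e (false, false)) (G.pt e (false, true)) (G.pt e a) (G.pt e a') := by
  set m := mergeBlocks r (G.pt e (false, false)) (G.pt e (false, true))
  have hm : G.boundaries ≤ m := hr.trans (le_mergeBlocks _ _ _)
  have h1 : m (G.pt e (false, false)) (G.pt e (false, true)) := mergeBlocks_rel _ _ _
  have h2 : ∀ i j, m (G.pt e (i, j)) (G.pt e (!i, !j)) := fun i j => hm (G.boundaries_pt e i j)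
  have key : ∀ a, m (G.pt e (false, false)) (G.pt e a) := by
    rintro ⟨_ | _, _ | _⟩
    · exact m.refl _
    · exact h1
    · exact m.trans h1 (h2 false true)
    · exact h2 false false
  exact m.trans (m.symm (key a)) (key a')

end ArrowPresentation

namespace VertexPartitioned

variable {P E P' E' : Type u} (G : VertexPartitioned P E)

/-- The number of vertex classes. -/
noncomputable def numVertexClasses : ℕ := Nat.card (Quotient G.vcls)

/-- Merge the vertex classes of the two vertices incident to `e`. -/
def mergedVertices (e : E) : Setoid P :=
  mergeBlocks G.vcls (G.pt e (false, false)) (G.pt e (true, false))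

def delete (e : E) : VertexPartitioned P {g : E // g ≠ e} where
  toArrowPresentation := G.toArrowPresentation.delete e
  vcls := G.vcls
  circles_le := G.circles_le

noncomputable def contract (e : E) : VertexPartitioned P {g : E // g ≠ e} where
  toArrowPresentation := G.toArrowPresentation.contract e
  vcls := G.mergedVertices e
  circles_le := G.reconnect_circles_le e _ _ _ _ G.circles_le

noncomputable def penrose (e : E) : VertexPartitioned P {g : E // g ≠ e} where
  toArrowPresentation := G.toArrowPresentation.penrose e
  vcls := G.mergedVertices e
  circles_le := G.reconnect_circles_le e _ _ _ _ G.circles_le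

def mergeDelete (e : E) : VertexPartitioned P {g : E // g ≠ e} where
  toArrowPresentation := G.toArrowPresentation.delete e
  vcls := G.mergedVertices e
  circles_le := (G.delete e).circles_le.trans (le_mergeBlocks _ _ _)

/-- Generates the vertex partition of a 2-sum: the two vertex partitions, together with the merging
of the classes of the vertices carrying coupled arrows (each new vertex lies in the class of the
arcs that it is made of). -/
inductive SumStep (G : VertexPartitioned P E) (f : E) (H : VertexPartitioned P' E') (e : E')
    (φ : Coupling) : P ⊕ P' → P ⊕ P' → Prop
  | left {x y : P} : G.vcls x y → SumStep G f H e φ (Sum.inl x) (Sum.inl y)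
  | right {x y : P'} : H.vcls x y → SumStep G f H e φ (Sum.inr x) (Sum.inr y)
  | glue (i : Bool) :
      SumStep G f H e φ (Sum.inl (G.pt f (i, false))) (Sum.inr (H.pt e (φ i, false)))

/-- The 2-sum of vertex partitioned arrow presentations. -/
noncomputable def twoSum (G : VertexPartitioned P E) (f : E) (H : VertexPartitioned P' E')
    (e : E') (φ : Coupling) :
    VertexPartitioned (P ⊕ P') ({g : E // g ≠ f} ⊕ {g : E' // g ≠ e}) where
  toArrowPresentation := G.toArrowPresentation.twoSum f H.toArrowPresentation e φ
  vcls := Relation.EqvGen.setoid (SumStep G f H e φ)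
  circles_le := by
    set m := Relation.EqvGen.setoid (SumStep G f H e φ)
    have hl : ∀ {x y}, G.vcls x y → m (Sum.inl x) (Sum.inl y) :=
      fun h => Relation.EqvGen.rel _ _ (SumStep.left h)
    have hr : ∀ {x y}, H.vcls x y → m (Sum.inr x) (Sum.inr y) :=
      fun h => Relation.EqvGen.rel _ _ (SumStep.right h)
    have h0 : ∀ i, m (Sum.inl (G.pt f (i, false))) (Sum.inr (H.pt e (φ i, false))) :=
      fun i => Relation.EqvGen.rel _ _ (SumStep.glue i)
    have hg : ∀ i j, m (Sum.inl (G.pt f (i, j))) (Sum.inr (H.pt e (φ i, j))) := by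
      rintro i (_ | _)
      · exact h0 i
      · have h1 := hl (G.circles_le (G.circles_seg (G.pt f (i, true))))
        have h2 := hr (H.circles_le (H.circles_seg (H.pt e (φ i, false))))
        rw [G.seg_pt] at h1
        rw [H.seg_pt] at h2
        exact m.trans h1 (m.trans (h0 i) h2)
    apply eqvGen_setoid_le
    rintro x y (rfl | rfl)
    · rcases x with x | x
      · exact hl (G.circles_le (G.circles_gap x))
      · exact hr (H.circles_le (H.circles_gap x))
    · change m x (reglue (ArrowPresentation.sumEnds G.toArrowPresentation f
        H.toArrowPresentation e) (ArrowPresentation.sumMatch φ) (Sum.map G.seg H.seg) x)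
      by_cases hx : ∃ a, ArrowPresentation.sumEnds G.toArrowPresentation f
          H.toArrowPresentation e a = x
      · obtain ⟨a, rfl⟩ := hx
        rw [reglue_apply (ArrowPresentation.sumEnds_injective _ _ _ _)]
        rcases a with ⟨i, j⟩ | ⟨i, j⟩
        · exact hg i j
        · have := m.symm (hg (φ.symm i) j)
          rwa [Equiv.apply_symm_apply] at this
      · push Not at hx
        rw [reglue_of_not x hx]
        rcases x with x | x
        · exact hl (G.circles_le (G.circles_seg x))
        · exact hr (H.circles_le (H.circles_seg x))

end VertexPartitioned

namespace Packaged

variable {P E : Type u} (G : Packaged P E)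

/-- The number of boundary classes. -/
noncomputable def numBoundaryClasses : ℕ := Nat.card (Quotient G.bcls)

/-- Merge the boundary classes of the two boundary components incident to `e`. -/
def mergedBoundaries (e : E) : Setoid P :=
  mergeBlocks G.bcls (G.pt e (false, false)) (G.pt e (false, true))

theorem delete_boundaries_le (e : E) :
    (G.toArrowPresentation.delete e).boundaries ≤ G.mergedBoundaries e := by
  refine G.boundaries_le_of_step rfl (fun _ => rfl) (fun _ _ => rfl)
    (G.boundaries_le.trans (le_mergeBlocks _ _ _)) ?_
  rintro ⟨i, j⟩
  change G.mergedBoundaries e _ (G.seg _)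
  rw [G.seg_pt]
  exact G.merge_ends e _ G.boundaries_le _ _

theorem contract_boundaries_le (e : E) :
    (G.toArrowPresentation.contract e).boundaries ≤ G.bcls := by
  refine G.boundaries_le_of_step rfl (fun _ => rfl) (fun x hx => reglue_of_not x hx)
    G.boundaries_le ?_
  rintro ⟨i, j⟩
  change G.bcls _ (reglue (G.pt e) _ G.seg _)
  rw [reglue_apply (G.pt_injective e)]
  exact G.boundaries_le (G.boundaries_pt e i j)

theorem penrose_boundaries_le (e : E) :
    (G.toArrowPresentation.penrose e).boundaries ≤ G.mergedBoundaries e := by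
  refine G.boundaries_le_of_step rfl (fun _ => rfl) (fun x hx => reglue_of_not x hx)
    (G.boundaries_le.trans (le_mergeBlocks _ _ _)) ?_
  rintro ⟨i, j⟩
  change G.mergedBoundaries e _ (reglue (G.pt e) _ G.seg _)
  rw [reglue_apply (G.pt_injective e)]
  exact G.merge_ends e _ G.boundaries_le _ _

def delete (e : E) : Packaged P {g : E // g ≠ e} where
  toVertexPartitioned := G.toVertexPartitioned.delete e
  bcls := G.mergedBoundaries e
  boundaries_le := G.delete_boundaries_le e

noncomputable def contract (e : E) : Packaged P {g : E // g ≠ e} where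
  toVertexPartitioned := G.toVertexPartitioned.contract e
  bcls := G.bcls
  boundaries_le := G.contract_boundaries_le e

noncomputable def penrose (e : E) : Packaged P {g : E // g ≠ e} where
  toVertexPartitioned := G.toVertexPartitioned.penrose e
  bcls := G.mergedBoundaries e
  boundaries_le := G.penrose_boundaries_le e

def mergeDelete (e : E) : Packaged P {g : E // g ≠ e} where
  toVertexPartitioned := G.toVertexPartitioned.mergeDelete e
  bcls := G.mergedBoundaries e
  boundaries_le := G.delete_boundaries_le e

noncomputable def mergeContract (e : E) : Packaged P {g : E // g ≠ e} where
  toVertexPartitioned := G.toVertexPartitioned.contract e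
  bcls := G.mergedBoundaries e
  boundaries_le := (G.contract_boundaries_le e).trans (le_mergeBlocks _ _ _)

end Packaged

/-- The two properties that determine the polynomial `Q`, in the variables
`a, b, c, x, y, α, β, γ` (in this order): the recursion at an arbitrary edge, and the value on
edgeless packaged arrow presentations. -/
structure IsQ
    (Q : ∀ (P E : Type u) [Finite P] [Finite E], Packaged P E → MvPolynomial (Fin 8) ℤ) :
    Prop where
  edge : ∀ (P E : Type u) [Finite P] [Finite E] (G : Packaged P E) (e : E),
    Q P E G =
      MvPolynomial.X 0 * Q P _ (G.delete e) + MvPolynomial.X 1 * Q P _ (G.contract e) +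
      MvPolynomial.X 2 * Q P _ (G.penrose e) + MvPolynomial.X 3 * Q P _ (G.mergeDelete e) +
      MvPolynomial.X 4 * Q P _ (G.mergeContract e)
  edgeless : ∀ (P E : Type u) [Finite P] [Finite E] (G : Packaged P E), IsEmpty E →
    Q P E G =
      MvPolynomial.X 5 ^ G.numVertices * MvPolynomial.X 6 ^ G.numVertexClasses *
      MvPolynomial.X 7 ^ G.numBoundaryClasses

theorem IsQ.unique
    {Q Q' : ∀ (P E : Type u) [Finite P] [Finite E], Packaged P E → MvPolynomial (Fin 8) ℤ}
    (h : IsQ Q) (h' : IsQ Q') : Q = Q' := by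
  have key : ∀ (n : ℕ) (P E : Type u) [Finite P] [Finite E] (G : Packaged P E),
      Nat.card E = n → Q P E G = Q' P E G := by
    intro n
    induction n with
    | zero =>
      intro P E _ _ G hn
      have hE : IsEmpty E := Finite.card_eq_zero_iff.mp hn
      rw [h.edgeless P E G hE, h'.edgeless P E G hE]
    | succ n ih =>
      intro P E _ _ G hn
      have : Nonempty E := (Finite.card_pos_iff).mp (by omega)
      obtain ⟨e⟩ := this
      have hc : Nat.card {g : E // g ≠ e} = n := by
        classical
        have := Fintype.ofFinite E
        rw [Nat.card_eq_fintype_card] at hn ⊢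
        rw [Fintype.card_subtype_compl, Fintype.card_subtype_eq]
        omega
      rw [h.edge P E G e, h'.edge P E G e, ih _ _ _ hc, ih _ _ _ hc, ih _ _ _ hc, ih _ _ _ hc,
        ih _ _ _ hc]
  funext P E _ _ G
  exact key _ P E G rfl

/-!
Existence: the sum over all assignments of operations (coded `0, …, 4` for deletion, contraction,
Penrose-contraction, merge-deletion, merge-contraction) to the edges.
-/

namespace QState

variable {P E : Type u}

/-- How the four ends of the arrows of an edge are joined. -/
def turn (o : Fin 5) (a : Bool × Bool) : Bool × Bool :=
  ![(a.1, !a.2), (!a.1, !a.2), (!a.1, a.2), (a.1, !a.2), (!a.1, !a.2)] o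

def Step (G : ArrowPresentation P E) (s : E → Fin 5) (x y : P) : Prop :=
  y = G.gap x ∨ ((∀ e a, x ≠ G.pt e a) ∧ y = G.seg x) ∨
    ∃ e a, x = G.pt e a ∧ y = G.pt e (turn (s e) a)

/-- Merge the blocks of `p e` and `q e` for all `e` satisfying `S`. -/
def joinPairs {F : Type*} (r : Setoid P) (S : F → Prop) (p q : F → P) : Setoid P :=
  r ⊔ Relation.EqvGen.setoid (fun x y => ∃ e, S e ∧ x = p e ∧ y = q e)

theorem joinPairs_pos (r : Setoid P) (S : E → Prop) (p q : E → P) (e : E) (he : S e) :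
    joinPairs (mergeBlocks r (p e) (q e)) (fun g : {g : E // g ≠ e} => S g.1)
      (fun g => p g.1) (fun g => q g.1) = joinPairs r S p q := by
  apply le_antisymm
  · refine sup_le (sup_le le_sup_left ?_) ?_
    · refine le_sup_of_le_right (eqvGen_setoid_le ?_)
      rintro x y ⟨rfl, rfl⟩
      exact Relation.EqvGen.rel _ _ ⟨e, he, rfl, rfl⟩
    · refine le_sup_of_le_right (eqvGen_setoid_le ?_)
      rintro x y ⟨g, hg, rfl, rfl⟩
      exact Relation.EqvGen.rel _ _ ⟨g.1, hg, rfl, rfl⟩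
  · refine sup_le (le_sup_of_le_left le_sup_left) (eqvGen_setoid_le ?_)
    rintro x y ⟨g, hg, rfl, rfl⟩
    by_cases hge : g = e
    · subst hge
      exact (le_sup_left : _ ≤ joinPairs _ _ _ _) (mergeBlocks_rel r (p g) (q g))
    · exact (le_sup_right : _ ≤ joinPairs _ _ _ _)
        (Relation.EqvGen.rel _ _ ⟨⟨g, hge⟩, hg, rfl, rfl⟩)

theorem joinPairs_neg (r : Setoid P) (S : E → Prop) (p q : E → P) (e : E) (he : ¬ S e) :
    joinPairs r (fun g : {g : E // g ≠ e} => S g.1)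
      (fun g => p g.1) (fun g => q g.1) = joinPairs r S p q := by
  unfold joinPairs
  congr 2
  funext x y
  apply propext
  constructor
  · rintro ⟨g, hg, rfl, rfl⟩
    exact ⟨g.1, hg, rfl, rfl⟩
  · rintro ⟨g, hg, rfl, rfl⟩
    exact ⟨⟨g, fun h => he (h ▸ hg)⟩, hg, rfl, rfl⟩

theorem joinPairs_empty {F : Type*} [IsEmpty F] (r : Setoid P) (S : F → Prop) (p q : F → P) :
    joinPairs r S p q = r :=
  le_antisymm (sup_le le_rfl (eqvGen_setoid_le fun _ _ ⟨e, _⟩ => isEmptyElim e)) le_sup_left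

theorem step_eq (G : ArrowPresentation P E) (s : E → Fin 5) {e : E}
    (K : ArrowPresentation P {g : E // g ≠ e}) (hgap : K.gap = G.gap)
    (hpt : ∀ g, K.pt g = G.pt g.1) (hseg : ∀ x, (∀ a, G.pt e a ≠ x) → K.seg x = G.seg x)
    (he : ∀ a, K.seg (G.pt e a) = G.pt e (turn (s e) a)) :
    Step K (fun g => s g.1) = Step G s := by
  funext x y
  apply propext
  constructor
  · rintro (rfl | ⟨hx, rfl⟩ | ⟨g, a, rfl, rfl⟩)
    · exact Or.inl (by rw [hgap])
    · by_cases h : ∃ a, G.pt e a = x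
      · obtain ⟨a, rfl⟩ := h
        exact Or.inr (Or.inr ⟨e, a, rfl, he a⟩)
      · push Not at h
        refine Or.inr (Or.inl ⟨?_, hseg x h⟩)
        intro g a hga
        by_cases hg : g = e
        · subst hg
          exact h a hga.symm
        · refine hx ⟨g, hg⟩ a ?_
          rw [hpt]
          exact hga
    · exact Or.inr (Or.inr ⟨g.1, a, by rw [hpt], by rw [hpt]⟩)
  · rintro (rfl | ⟨hx, rfl⟩ | ⟨g, a, rfl, rfl⟩)
    · exact Or.inl (by rw [hgap])
    · refine Or.inr (Or.inl ⟨fun g a => ?_, (hseg x fun a h => hx e a h.symm).symm⟩)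
      rw [hpt]
      exact hx g.1 a
    · by_cases hg : g = e
      · subst hg
        refine Or.inr (Or.inl ⟨fun g' a' h => ?_, (he a).symm⟩)
        rw [hpt] at h
        exact g'.2 (G.pt_inj _ _ _ _ h).1.symm
      · exact Or.inr (Or.inr ⟨⟨g, hg⟩, a, by rw [hpt], by rw [hpt]⟩)

/-- The monomial of `α`, `β`, `γ` contributed by a state. -/
noncomputable def mono (G : Packaged P E) (s : E → Fin 5) : MvPolynomial (Fin 8) ℤ :=
  MvPolynomial.X 5 ^ Nat.card (Quotient (Relation.EqvGen.setoid (Step G.toArrowPresentation s))) *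
  MvPolynomial.X 6 ^ Nat.card (Quotient (joinPairs G.vcls (fun e => s e ≠ 0)
    (fun e => G.pt e (false, false)) (fun e => G.pt e (true, false)))) *
  MvPolynomial.X 7 ^ Nat.card (Quotient (joinPairs G.bcls (fun e => s e ≠ 1)
    (fun e => G.pt e (false, false)) (fun e => G.pt e (false, true))))

noncomputable def op (G : Packaged P E) (e : E) : Fin 5 → Packaged P {g : E // g ≠ e} :=
  ![G.delete e, G.contract e, G.penrose e, G.mergeDelete e, G.mergeContract e]

theorem mono_op (G : Packaged P E) (e : E) (s : E → Fin 5) :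
    mono (op G e (s e)) (fun g => s g.1) = mono G s := by
  have h1 : Step (op G e (s e)).toArrowPresentation (fun g => s g.1) =
      Step G.toArrowPresentation s := by
    refine step_eq _ _ _ ?_ ?_ ?_ ?_ <;> generalize s e = o <;> fin_cases o <;>
      first
      | rfl
      | exact fun _ => rfl
      | exact fun _ _ => rfl
      | exact fun a => G.seg_pt e a.1 a.2
      | exact fun x hx => reglue_of_not x hx
      | exact fun a => reglue_apply (G.pt_injective e) a
  have h2 : joinPairs (op G e (s e)).vcls (fun g : {g : E // g ≠ e} => s g.1 ≠ 0)
      (fun g => (op G e (s e)).pt g (false, false))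
      (fun g => (op G e (s e)).pt g (true, false)) =
      joinPairs G.vcls (fun e => s e ≠ 0)
      (fun e => G.pt e (false, false)) (fun e => G.pt e (true, false)) := by
    by_cases h : s e = 0
    · rw [← joinPairs_neg G.vcls (fun e => s e ≠ 0) _ _ e (by simpa using h), h]
      rfl
    · rw [← joinPairs_pos G.vcls (fun e => s e ≠ 0) _ _ e h]
      generalize s e = o at *
      fin_cases o
      · exact absurd rfl h
      all_goals rfl
  have h3 : joinPairs (op G e (s e)).bcls (fun g : {g : E // g ≠ e} => s g.1 ≠ 1)
      (fun g => (op G e (s e)).pt g (false, false))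
      (fun g => (op G e (s e)).pt g (false, true)) =
      joinPairs G.bcls (fun e => s e ≠ 1)
      (fun e => G.pt e (false, false)) (fun e => G.pt e (false, true)) := by
    by_cases h : s e = 1
    · rw [← joinPairs_neg G.bcls (fun e => s e ≠ 1) _ _ e (by simpa using h), h]
      rfl
    · rw [← joinPairs_pos G.bcls (fun e => s e ≠ 1) _ _ e h]
      generalize s e = o at *
      fin_cases o
      · rfl
      · exact absurd rfl h
      all_goals rfl
  unfold mono
  rw [h1, h2, h3]

/-- The variable recording the operation `o`. -/
noncomputable def weight (o : Fin 5) : MvPolynomial (Fin 8) ℤ :=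
  MvPolynomial.X (Fin.castLE (by decide) o)

noncomputable def stateSum [Fintype E] [DecidableEq E] (G : Packaged P E) :
    MvPolynomial (Fin 8) ℤ :=
  ∑ s : E → Fin 5, (∏ e, weight (s e)) * mono G s

theorem stateSum_edge [Fintype E] [DecidableEq E] (G : Packaged P E) (e : E) :
    stateSum G = ∑ o, weight o * stateSum (op G e o) := by
  unfold stateSum
  rw [← Equiv.sum_comp (Equiv.funSplitAt e (Fin 5)).symm, Fintype.sum_prod_type]
  refine Finset.sum_congr rfl fun o _ => ?_
  rw [Finset.mul_sum]
  refine Finset.sum_congr rfl fun s' _ => ?_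
  set s := (Equiv.funSplitAt e (Fin 5)).symm (o, s') with hs
  have hse : s e = o := by simp [hs, Equiv.funSplitAt]
  have hs' : (fun g : {g : E // g ≠ e} => s g.1) = s' := by
    funext g
    simp [hs, Equiv.funSplitAt, g.2]
  have := mono_op G e s
  rw [hse, hs'] at this
  rw [this, ← mul_assoc, Fintype.prod_eq_mul_prod_subtype_ne _ e, hse, ← hs']

theorem stateSum_empty [Fintype E] [DecidableEq E] [IsEmpty E] (G : Packaged P E) :
    stateSum G =
      MvPolynomial.X 5 ^ G.numVertices * MvPolynomial.X 6 ^ G.numVertexClasses *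
      MvPolynomial.X 7 ^ G.numBoundaryClasses := by
  have h : ∀ s : E → Fin 5,
      Relation.EqvGen.setoid (Step G.toArrowPresentation s) = G.circles := by
    intro s
    unfold ArrowPresentation.circles
    congr 1
    funext x y
    simp [Step]
  simp only [stateSum, Fintype.sum_unique, mono, Finset.univ_eq_empty, Finset.prod_empty, one_mul,
    h, joinPairs_empty]
  rfl

end QState

open Classical in
theorem isQ_stateSum :
    IsQ (fun (P E : Type u) [Finite P] [Finite E] (G : Packaged P E) =>
      letI := Fintype.ofFinite E; QState.stateSum G) where
  edge P E _ _ G e := by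
    let _ : Fintype E := Fintype.ofFinite E
    rw [QState.stateSum_edge G e, Fin.sum_univ_five]
    congr!
  edgeless P E _ _ G hE := by
    let _ : Fintype E := Fintype.ofFinite E
    exact QState.stateSum_empty G

theorem existsUnique_isQ :
    ∃! Q : ∀ (P E : Type u) [Finite P] [Finite E], Packaged P E → MvPolynomial (Fin 8) ℤ, IsQ Q :=
  ⟨_, isQ_stateSum, fun _ h => h.unique isQ_stateSum⟩

namespace Packaged

variable {P E : Type u} [Finite P] [Finite E]

/-- The polynomial `Q(G) ∈ ℤ[a, b, c, x, y, α, β, γ]`. -/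
noncomputable def Q (G : Packaged P E) : MvPolynomial (Fin 8) ℤ :=
  existsUnique_isQ.choose P E G

/-- The value `Q(G; a, b, c, x, y, α, β, γ)` at elements of a commutative ring. -/
noncomputable def Qval {R : Type*} [CommRing R] (G : Packaged P E) (a b c x y α β γ : R) : R :=
  MvPolynomial.aeval ![a, b, c, x, y, α, β, γ] G.Q

end Packaged

namespace VertexPartitioned

variable {P E : Type u}

/-- Regard a vertex partitioned arrow presentation as a packaged one with all boundary components
in the same block. -/
def toPackaged (G : VertexPartitioned P E) : Packaged P E where
  toVertexPartitioned := G
  bcls := ⊤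
  boundaries_le := le_top

/-- The polynomial `Q̂(G; a, b, c, x, α, β) = Q(G; a, b, c, x, 0, α, β, 1)`. -/
noncomputable def Qhat [Finite P] [Finite E] {R : Type*} [CommRing R] (G : VertexPartitioned P E)
    (a b c x α β : R) : R :=
  G.toPackaged.Qval a b c x 0 α β 1

/-- The polynomial `Q̂` can be computed with any boundary partition. -/
theorem Qval_eq_Qhat [Finite P] [Finite E] {R : Type*} [CommRing R] (G : Packaged P E)
    (a b c x α β : R) :
    G.Qval a b c x 0 α β 1 = G.toVertexPartitioned.Qhat a b c x α β := by
  classical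
  have hQ := existsUnique_isQ.choose_spec.1.unique isQ_stateSum
  unfold Qhat Packaged.Qval Packaged.Q
  rw [hQ]
  simp only [QState.stateSum, map_sum, map_mul]
  refine Finset.sum_congr rfl fun s _ => ?_
  congr 1
  simp [QState.mono, toPackaged]

end VertexPartitioned

/-- A finite vertex partitioned arrow presentation, bundled with its points and edges. -/
structure FinVertexPartitioned where
  Point : Type u
  Edge : Type u
  [finitePoint : Finite Point]
  [finiteEdge : Finite Edge]
  pres : VertexPartitioned Point Edge

attribute [instance] FinVertexPartitioned.finitePoint FinVertexPartitioned.finiteEdge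

/-- The remaining edges among `f 0, …, f n` after the 2-sum at `f 0`. -/
def nextEdges {E F : Type u} {n : ℕ} (f : Fin (n + 1) ↪ E) :
    Fin n ↪ {g : E // g ≠ f 0} ⊕ F where
  toFun i := Sum.inl ⟨f i.succ, fun h => Fin.succ_ne_zero i (f.injective h)⟩
  inj' i j h := by
    have := Subtype.ext_iff.mp (Sum.inl.inj h)
    exact Fin.succ_injective n (f.injective this)

/-- The iterated 2-sum `G ⊕ H ⊕ ⋯ ⊕ H`: at each of the distinct edges `f 0, …, f (n - 1)` of `G`,
one after the other, form the 2-sum with a new copy of `H` along its edge `e`. -/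
noncomputable def iteratedTwoSum {P' E' : Type u} [Finite P'] [Finite E']
    (H : VertexPartitioned P' E') (e : E') :
    (n : ℕ) → {P E : Type u} → [Finite P] → [Finite E] → VertexPartitioned P E → (Fin n ↪ E) →
      (Fin n → Coupling) → FinVertexPartitioned.{u}
  | 0, _, _, _, _, G, _, _ => ⟨_, _, G⟩
  | n + 1, _, _, _, _, G, f, φ =>
      iteratedTwoSum H e n (G.twoSum (f 0) H e (φ 0)) (nextEdges f) (fun i => φ i.succ)

/-- The tensor product of `G` with `H` along the edge `e` of `H`: the 2-sum with a copy of `H` is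
formed at every edge of `G`, the edges being taken in the order `o`. -/
noncomputable def tensor {P E P' E' : Type u} [Finite P] [Finite E] [Finite P'] [Finite E']
    (G : VertexPartitioned P E) (H : VertexPartitioned P' E') (e : E') (φ : E → Coupling)
    {n : ℕ} (o : Fin n ≃ E) : FinVertexPartitioned.{u} :=
  iteratedTwoSum H e n G o.toEmbedding (fun i => φ (o i))

/-! Expanding the recursion at every edge writes `Qhat` as a sum over states, that is, over choices
of an operation at each edge; a state contributes the product of its weights times a power of `α`
counting circles and a power of `β` counting vertex classes. Everything follows from looking at a
state of `H` with the arrows of `e` removed.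

In such an open state the four ends of `e` are the ends of two arcs, so they are paired in one of
three ways, those of deletion, contraction and Penrose-contraction. The last two pairings connect
the two arrows and force their vertex classes to agree; with the first one the classes may be
distinct or merged. This gives four types, matching the four operations of `Qhat`, while
merge-contraction never occurs (`exists_stateType`). Let `Φ t` (`typeSum`) be the sum over the
states of type `t`, counting only circles and classes that avoid `e`.

Seen from `G`, gluing in an open state of type `t` at an edge `f` has the effect of performing
operation `t` at `f`, apart from those free circles and classes. Hence a 2-sum amounts to replacing
the weights at `f` by `Φ` (`weightedSum_twoSum`), and iteration treats the tensor product
(`Qhat_tensor`).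

Closing the open states of `H` by operation `o` instead gives two circles through `e` if the
pairings of `o` and `t` agree and one otherwise, and two classes at `e` only for `o = t = 0`. These
exponents are the matrix entries (`Qhat_op`), so `Φ` solves the system, and the explicit determinant
(`det_system`) gives uniqueness. -/

/-! ### Counting the classes of glued equivalence relations. -/

section Gluing

variable {P P' ι : Type*}

/-- The relation on the disjoint union that extends `r` and `r'` and relates `p i` to `q i`. -/
inductive GlueStep (r : Setoid P) (r' : Setoid P') (p : ι → P) (q : ι → P') :
    P ⊕ P' → P ⊕ P' → Prop
  | left {x y : P} : r x y → GlueStep r r' p q (Sum.inl x) (Sum.inl y)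
  | right {x y : P'} : r' x y → GlueStep r r' p q (Sum.inr x) (Sum.inr y)
  | glue (i : ι) : GlueStep r r' p q (Sum.inl (p i)) (Sum.inr (q i))

/-- The equivalence relation on the disjoint union generated by `r`, `r'` and `p i ∼ q i`. -/
def glueSetoid (r : Setoid P) (r' : Setoid P') (p : ι → P) (q : ι → P') : Setoid (P ⊕ P') :=
  Relation.EqvGen.setoid (GlueStep r r' p q)

/-- The equivalence relation generated by `r` and `p i ∼ p j` for `R i j`. -/
def joinAlong (r : Setoid P) (p : ι → P) (R : ι → ι → Prop) : Setoid P :=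
  r ⊔ Relation.EqvGen.setoid (fun x y => ∃ i j, R i j ∧ x = p i ∧ y = p j)

variable {r : Setoid P} {r' : Setoid P'} {p : ι → P} {q : ι → P'}

theorem glueSetoid_le {m : Setoid (P ⊕ P')} (h : ∀ x y, r x y → m (Sum.inl x) (Sum.inl y))
    (h' : ∀ x y, r' x y → m (Sum.inr x) (Sum.inr y)) (hg : ∀ i, m (Sum.inl (p i)) (Sum.inr (q i))) :
    glueSetoid r r' p q ≤ m := by
  apply eqvGen_setoid_le
  rintro _ _ (h1 | h1 | i)
  exacts [h _ _ h1, h' _ _ h1, hg i]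

theorem glueSetoid_left {x y : P} (h : r x y) : glueSetoid r r' p q (Sum.inl x) (Sum.inl y) :=
  Relation.EqvGen.rel _ _ (.left h)

theorem glueSetoid_right {x y : P'} (h : r' x y) : glueSetoid r r' p q (Sum.inr x) (Sum.inr y) :=
  Relation.EqvGen.rel _ _ (.right h)

theorem glueSetoid_glue (i : ι) : glueSetoid r r' p q (Sum.inl (p i)) (Sum.inr (q i)) :=
  Relation.EqvGen.rel _ _ (.glue i)

theorem joinAlong_le {R : ι → ι → Prop} {m : Setoid P} (h : r ≤ m)
    (hR : ∀ i j, R i j → m (p i) (p j)) : joinAlong r p R ≤ m := by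
  refine sup_le h (eqvGen_setoid_le ?_)
  rintro _ _ ⟨i, j, hij, rfl, rfl⟩
  exact hR i j hij

theorem le_joinAlong {R : ι → ι → Prop} : r ≤ joinAlong r p R := le_sup_left

theorem joinAlong_rel {R : ι → ι → Prop} {i j : ι} (h : R i j) : joinAlong r p R (p i) (p j) :=
  (le_sup_right : _ ≤ joinAlong r p R) (Relation.EqvGen.rel _ _ ⟨i, j, h, rfl, rfl⟩)

/-- The number of classes that contain none of the points `q i`. -/
noncomputable def numFree (r' : Setoid P') (q : ι → P') : ℕ :=
  Nat.card {c : Quotient r' // ∀ i, Quotient.mk r' (q i) ≠ c}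

/-- Send a point whose class contains some `q i` to `f i`, and any other point to its class. -/
noncomputable def classify {γ : Type*} (r' : Setoid P') (q : ι → P') (f : ι → γ) (y : P') :
    γ ⊕ {c : Quotient r' // ∀ i, Quotient.mk r' (q i) ≠ c} :=
  open Classical in
  if h : ∃ i, r' (q i) y then Sum.inl (f h.choose)
  else Sum.inr ⟨Quotient.mk r' y, fun i hi => h ⟨i, Quotient.exact hi⟩⟩

/-- `classify` picks an arbitrary index; the hypothesis `hf` makes that choice immaterial. -/
theorem classify_of_rel {γ : Type*} {f : ι → γ} (hf : ∀ i j, r' (q i) (q j) → f i = f j)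
    {i : ι} {y : P'} (h : r' (q i) y) : classify r' q f y = Sum.inl (f i) := by
  have hy : ∃ i, r' (q i) y := ⟨i, h⟩
  rw [classify, dif_pos hy]
  exact congrArg _ (hf _ _ (r'.trans hy.choose_spec (r'.symm h)))

theorem classify_of_not {γ : Type*} {f : ι → γ} {y : P'} (h : ¬ ∃ i, r' (q i) y) :
    classify r' q f y =
      Sum.inr ⟨Quotient.mk r' y, fun i hi => h ⟨i, Quotient.exact hi⟩⟩ := by
  rw [classify, dif_neg h]

theorem classify_eq {γ : Type*} {f : ι → γ} (hf : ∀ i j, r' (q i) (q j) → f i = f j)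
    {x y : P'} (h : r' x y) : classify r' q f x = classify r' q f y := by
  by_cases hx : ∃ i, r' (q i) x
  · obtain ⟨i, hi⟩ := hx
    rw [classify_of_rel hf hi, classify_of_rel hf (r'.trans hi h)]
  · have hy : ¬ ∃ i, r' (q i) y := fun ⟨i, hi⟩ => hx ⟨i, r'.trans hi (r'.symm h)⟩
    rw [classify_of_not hx, classify_of_not hy]
    exact congrArg _ (Subtype.ext (Quotient.sound h))

theorem card_quotient_of_surjective {X Y : Type*} (s : Setoid X) (F : X → Y)
    (hF : Function.Surjective F) (h : ∀ x y, s x y → F x = F y) (h' : ∀ x y, F x = F y → s x y) :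
    Nat.card (Quotient s) = Nat.card Y := by
  have hs : s = Setoid.ker F := Setoid.ext fun x y => ⟨h x y, h' x y⟩
  rw [hs]
  exact Nat.card_congr (Setoid.quotientKerEquivOfSurjective F hF)

/-- The second summand influences the first only through which of the `q i` it relates. A class of
the glued relation that meets the first summand is therefore a class of `r` joined along these
relations, and the remaining classes are those of `r'` avoiding every `q i`. -/
theorem card_glueSetoid [Finite P] [Finite P'] (r : Setoid P) (r' : Setoid P') (p : ι → P)
    (q : ι → P') :
    Nat.card (Quotient (glueSetoid r r' p q)) =
      Nat.card (Quotient (joinAlong r p (fun i j => r' (q i) (q j)))) + numFree r' q := by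
  set m := joinAlong r p (fun i j => r' (q i) (q j))
  set g := glueSetoid r r' p q
  let f : ι → Quotient m := fun i => Quotient.mk m (p i)
  have hf : ∀ i j, r' (q i) (q j) → f i = f j := fun i j h => Quotient.sound (joinAlong_rel h)
  have hmg : m ≤ Setoid.comap Sum.inl g := by
    refine joinAlong_le (fun _ _ h => glueSetoid_left h) fun i j h => ?_
    exact g.trans (glueSetoid_glue i) (g.trans (glueSetoid_right h) (g.symm (glueSetoid_glue j)))
  rw [numFree, ← Nat.card_sum]
  refine card_quotient_of_surjective g
    (Sum.elim (fun x => Sum.inl (Quotient.mk m x)) (classify r' q f)) ?_ ?_ ?_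
  · rintro (c | ⟨c, hc⟩)
    · obtain ⟨x, rfl⟩ := Quotient.exists_rep c
      exact ⟨Sum.inl x, rfl⟩
    · obtain ⟨y, rfl⟩ := Quotient.exists_rep c
      exact ⟨Sum.inr y, classify_of_not fun ⟨i, hi⟩ => hc i (Quotient.sound hi)⟩
  · suffices h : g ≤ Setoid.ker
        (Sum.elim (fun x => Sum.inl (Quotient.mk m x)) (classify r' q f)) from fun x y h' => h h'
    refine glueSetoid_le (fun x y h => ?_) (fun x y h => ?_) fun i => ?_
    · exact congrArg Sum.inl (Quotient.sound (le_joinAlong h))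
    · exact classify_eq hf h
    · exact (classify_of_rel hf (r'.refl (q i))).symm
  · have h1 : ∀ x y, (Sum.inl (Quotient.mk m x) : _ ⊕ _) = classify r' q f y →
        g (Sum.inl x) (Sum.inr y) := by
      intro x y h
      by_cases hy : ∃ i, r' (q i) y
      · obtain ⟨i, hi⟩ := hy
        rw [classify_of_rel hf hi] at h
        exact g.trans (hmg (Quotient.exact (Sum.inl.inj h)))
          (g.trans (glueSetoid_glue i) (glueSetoid_right hi))
      · rw [classify_of_not hy] at h
        cases h
    rintro (x | x) (y | y) h
    · exact hmg (Quotient.exact (Sum.inl.inj h))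
    · exact h1 x y h
    · exact g.symm (h1 y x h.symm)
    · change classify r' q f x = classify r' q f y at h
      by_cases hx : ∃ i, r' (q i) x
      · obtain ⟨i, hi⟩ := hx
        -- Two points of the second summand with the same image need not be related by `r'`; they
        -- are connected through `p i` in the first summand.
        have h2 := h1 (p i) x (classify_of_rel hf hi).symm
        have h3 := h1 (p i) y (by rw [← h]; exact (classify_of_rel hf hi).symm)
        exact g.trans (g.symm h2) h3
      · by_cases hy : ∃ i, r' (q i) y
        · obtain ⟨i, hi⟩ := hy
          rw [classify_of_not hx, classify_of_rel hf hi] at h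
          cases h
        · rw [classify_of_not hx, classify_of_not hy] at h
          exact glueSetoid_right (Quotient.exact (Subtype.ext_iff.mp (Sum.inr.inj h)))

/-- Classes meeting some `q i` correspond to classes of indices, and the others are untouched by
`R`. This moves the count to `ι`, which will be the four ends or the two arrows of an edge. -/
theorem card_joinAlong [Finite P'] [Finite ι] (r' : Setoid P') (q : ι → P') (R : ι → ι → Prop) :
    Nat.card (Quotient (joinAlong r' q R)) =
      Nat.card (Quotient (Setoid.comap q r' ⊔ Relation.EqvGen.setoid R)) + numFree r' q := by
  set m := Setoid.comap q r' ⊔ Relation.EqvGen.setoid R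
  set g := joinAlong r' q R
  let f : ι → Quotient m := fun i => Quotient.mk m i
  have hf : ∀ i j, r' (q i) (q j) → f i = f j := fun i j h =>
    Quotient.sound ((le_sup_left : _ ≤ m) h)
  have hmg : m ≤ Setoid.comap q g :=
    sup_le (fun _ _ h => le_joinAlong h) (eqvGen_setoid_le fun i j h => joinAlong_rel h)
  rw [numFree, ← Nat.card_sum]
  refine card_quotient_of_surjective g (classify r' q f) ?_ ?_ ?_
  · rintro (c | ⟨c, hc⟩)
    · obtain ⟨i, rfl⟩ := Quotient.exists_rep c
      exact ⟨q i, classify_of_rel hf (r'.refl _)⟩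
    · obtain ⟨y, rfl⟩ := Quotient.exists_rep c
      exact ⟨y, classify_of_not fun ⟨i, hi⟩ => hc i (Quotient.sound hi)⟩
  · suffices h : g ≤ Setoid.ker (classify r' q f) from fun x y h' => h h'
    refine joinAlong_le (fun x y h => classify_eq hf h) fun i j h => ?_
    change classify r' q f (q i) = classify r' q f (q j)
    rw [classify_of_rel hf (r'.refl (q i)), classify_of_rel hf (r'.refl (q j))]
    exact congrArg _ (Quotient.sound ((le_sup_right : _ ≤ m) (Relation.EqvGen.rel _ _ h)))
  · intro x y h
    by_cases hx : ∃ i, r' (q i) x <;> by_cases hy : ∃ i, r' (q i) y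
    · obtain ⟨i, hi⟩ := hx
      obtain ⟨j, hj⟩ := hy
      rw [classify_of_rel hf hi, classify_of_rel hf hj] at h
      exact g.trans (g.symm (le_joinAlong hi))
        (g.trans (hmg (Quotient.exact (Sum.inl.inj h))) (le_joinAlong hj))
    · obtain ⟨i, hi⟩ := hx
      rw [classify_of_rel hf hi, classify_of_not hy] at h
      cases h
    · obtain ⟨i, hi⟩ := hy
      rw [classify_of_not hx, classify_of_rel hf hi] at h
      cases h
    · rw [classify_of_not hx, classify_of_not hy] at h
      exact le_joinAlong (Quotient.exact (Subtype.ext_iff.mp (Sum.inr.inj h)))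

end Gluing

/-! ### Orbits of two involutions: an arc has exactly two ends. -/

section Involutions

variable {P : Type*} {g s : Equiv.Perm P}

/-- The dihedral relation: conjugation by `s` inverts `s * g`. -/
theorem zpow_mul_apply_of_involutive (hg : ∀ x, g (g x) = x) (hs : ∀ x, s (s x) = x) (n : ℤ)
    (x : P) : s (((s * g) ^ n) x) = ((s * g) ^ (-n)) (s x) := by
  have hs' : s⁻¹ = s := Equiv.ext fun x => (Equiv.symm_apply_eq s).2 (hs x).symm
  have hg' : g⁻¹ = g := Equiv.ext fun x => (Equiv.symm_apply_eq g).2 (hg x).symm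
  have h1 : s * (s * g) * s⁻¹ = (s * g)⁻¹ := by
    rw [mul_inv_rev, hg', hs', ← mul_assoc]
    congr 1
    exact mul_eq_right.2 (Equiv.ext hs)
  have h2 : s * (s * g) ^ n * s⁻¹ = (s * g) ^ (-n) := by
    rw [← conj_zpow, h1, inv_zpow']
  rw [← h2]
  simp [hs', hs]

theorem apply_zpow_of_fixed (hg : ∀ x, g (g x) = x) (hs : ∀ x, s (s x) = x) {a : P}
    (ha : s a = a) (n : ℤ) : g (((s * g) ^ n) a) = ((s * g) ^ (-n - 1)) a := by
  have h : ((s * g) ^ (1 + n)) a = s (g (((s * g) ^ n) a)) := by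
    rw [zpow_add, zpow_one]
    rfl
  rw [← hs (g (((s * g) ^ n) a)), ← h, zpow_mul_apply_of_involutive hg hs, ha]
  congr 2
  ring

/-- The class of a fixed point of `s` under the equivalence relation generated by two involutions
`g` and `s` is an orbit of `s * g`. -/
theorem exists_zpow_of_eqvGen (hg : ∀ x, g (g x) = x) (hs : ∀ x, s (s x) = x) {a : P}
    (ha : s a = a) {b : P}
    (h : Relation.EqvGen.setoid (fun x y => y = g x ∨ y = s x) a b) :
    ∃ n : ℤ, ((s * g) ^ n) a = b := by
  -- The kernel of a predicate expresses that it is constant on classes: lying on the orbit of `a`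
  -- is preserved by `g` and by `s`.
  have hle : Relation.EqvGen.setoid (fun x y => y = g x ∨ y = s x) ≤
      Setoid.ker (fun x => ∃ n : ℤ, ((s * g) ^ n) a = x) := by
    have hg' : ∀ x, (∃ n : ℤ, ((s * g) ^ n) a = x) → ∃ n : ℤ, ((s * g) ^ n) a = g x := by
      rintro _ ⟨n, rfl⟩
      exact ⟨_, (apply_zpow_of_fixed hg hs ha n).symm⟩
    have hs' : ∀ x, (∃ n : ℤ, ((s * g) ^ n) a = x) → ∃ n : ℤ, ((s * g) ^ n) a = s x := by
      rintro _ ⟨n, rfl⟩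
      exact ⟨-n, by rw [zpow_mul_apply_of_involutive hg hs, ha]⟩
    apply eqvGen_setoid_le
    rintro x y (rfl | rfl)
    · exact propext ⟨hg' x, fun h => by simpa [hg] using hg' _ h⟩
    · exact propext ⟨hs' x, fun h => by simpa [hs] using hs' _ h⟩
  have := hle h
  exact (iff_of_eq this).1 ⟨0, rfl⟩

/-- Since `s` sends `(s * g) ^ n a` to `(s * g) ^ (-n) a`, being fixed means `(s * g) ^ (2 * n) a =
a`. -/
theorem zpow_apply_fixed_iff (hg : ∀ x, g (g x) = x) (hs : ∀ x, s (s x) = x) {a : P}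
    (ha : s a = a) (n : ℤ) :
    s (((s * g) ^ n) a) = ((s * g) ^ n) a ↔ (MulAction.period (s * g) a : ℤ) ∣ 2 * n := by
  rw [← MulAction.zpow_smul_eq_iff_period_dvd, zpow_mul_apply_of_involutive hg hs, ha,
    Equiv.Perm.smul_def, two_mul, zpow_add, Equiv.Perm.mul_apply, zpow_neg, Equiv.Perm.inv_def,
    Equiv.symm_apply_eq]
  exact eq_comm

/-- Among the points of a class, at most two are fixed by `s`. -/
theorem eq_of_fixed (hg : ∀ x, g (g x) = x) (hs : ∀ x, s (s x) = x) {a b c : P}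
    (ha : s a = a) (hb : s b = b) (hc : s c = c)
    (hab : Relation.EqvGen.setoid (fun x y => y = g x ∨ y = s x) a b)
    (hac : Relation.EqvGen.setoid (fun x y => y = g x ∨ y = s x) a c) (hba : b ≠ a) (hca : c ≠ a) :
    b = c := by
  obtain ⟨i, rfl⟩ := exists_zpow_of_eqvGen hg hs ha hab
  obtain ⟨j, rfl⟩ := exists_zpow_of_eqvGen hg hs ha hac
  rw [zpow_apply_fixed_iff hg hs ha] at hb hc
  have hi : ¬ (MulAction.period (s * g) a : ℤ) ∣ i := fun h =>
    hba (MulAction.zpow_smul_eq_iff_period_dvd.2 h)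
  have hj : ¬ (MulAction.period (s * g) a : ℤ) ∣ j := fun h =>
    hca (MulAction.zpow_smul_eq_iff_period_dvd.2 h)
  -- The period `m` divides `2 * i` and `2 * j` but neither `i` nor `j`, so both quotients `k` and
  -- `l` are odd. Their difference is even, hence `m` divides `i - j`.
  have key : (MulAction.period (s * g) a : ℤ) ∣ i - j := by
    obtain ⟨k, hk⟩ := hb
    obtain ⟨l, hl⟩ := hc
    generalize (MulAction.period (s * g) a : ℤ) = m at *
    have hk' : Odd k := by
      rw [← Int.not_even_iff_odd]
      rintro ⟨k, rfl⟩
      exact hi ⟨k, by linarith⟩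
    have hl' : Odd l := by
      rw [← Int.not_even_iff_odd]
      rintro ⟨l, rfl⟩
      exact hj ⟨l, by linarith⟩
    obtain ⟨d, hd⟩ := hk'.sub_odd hl'
    refine ⟨d, ?_⟩
    have : k = l + d + d := by linarith
    subst this
    linarith
  have := MulAction.zpow_smul_eq_iff_period_dvd.2 key
  rw [Equiv.Perm.smul_def] at this
  conv_lhs => rw [show i = j + (i - j) by ring, zpow_add, Equiv.Perm.mul_apply, this]

/-- If `g` has no fixed point, then each fixed point of `s` shares its class with another one. -/
theorem exists_fixed_ne [Finite P] (hg : ∀ x, g (g x) = x) (hg' : ∀ x, g x ≠ x)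
    (hs : ∀ x, s (s x) = x) {a : P} (ha : s a = a) :
    ∃ b, s b = b ∧ b ≠ a ∧
      Relation.EqvGen.setoid (fun x y => y = g x ∨ y = s x) a b := by
  set r := Relation.EqvGen.setoid (fun x y => y = g x ∨ y = s x) with hr
  have hstep : ∀ n : ℕ, r a (((s * g) ^ n) a) := by
    intro n
    induction n with
    | zero => exact r.refl _
    | succ n ih =>
      rw [pow_succ', Equiv.Perm.mul_apply]
      exact r.trans ih (r.trans (Relation.EqvGen.rel _ _ (Or.inl rfl))
        (Relation.EqvGen.rel _ _ (Or.inr rfl)))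
  have hpos : 0 < MulAction.period (s * g) a :=
    MulAction.period_pos_of_orderOf_pos (orderOf_pos _) a
  -- For an even period `2 * k` the point halfway round the orbit is the second fixed point of `s`.
  -- For an odd period `2 * k + 1` the point `(s * g) ^ k a` would be fixed by `g`.
  rcases Nat.even_or_odd' (MulAction.period (s * g) a) with ⟨k, hk | hk⟩
  · refine ⟨((s * g) ^ k) a, ?_, fun h => ?_, hstep k⟩
    · rw [← zpow_natCast, zpow_apply_fixed_iff hg hs ha, hk]
      push_cast
      exact dvd_rfl
    · have := Nat.le_of_dvd (by omega) 
        ((MulAction.pow_smul_eq_iff_period_dvd (m := s * g) (a := a)).1 h)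
      omega
  · exfalso
    apply hg' (((s * g) ^ (k : ℤ)) a)
    rw [apply_zpow_of_fixed hg hs ha]
    have : ((s * g) ^ (-(2 * k + 1 : ℤ))) a = a := by
      apply (MulAction.zpow_smul_eq_iff_period_dvd (g := s * g) (a := a)).2
      rw [hk]
      push_cast
      exact (dvd_neg.2 dvd_rfl)
    conv_rhs => rw [← this, ← Equiv.Perm.mul_apply, ← zpow_add]
    congr 2
    ring

end Involutions

/-! ### Pairings of the four ends of an edge. -/

namespace QState

theorem turn_turn (o : Fin 5) (a : Bool × Bool) : turn o (turn o a) = a := by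
  revert o a; decide

/-- The fixed-point free involutions of the four ends of an edge. -/
theorem exists_turn (π : Bool × Bool → Bool × Bool) (h : ∀ a, π a ≠ a) (h' : ∀ a, π (π a) = a) :
    ∃ t : Fin 3, ∀ a, π a = turn (t.castLE (by decide)) a := by
  have h0 := h (false, false)
  have h1 := h (false, true)
  have h2 := h (true, false)
  have h3 := h (true, true)
  have h4 := h' (false, false)
  have h5 := h' (false, true)
  have h6 := h' (true, false)
  have h7 := h' (true, true)
  clear h h'
  -- The partner of one end determines the whole pairing. Codes below `3` suffice because `turn`
  -- takes the same values at `3` as at `0`, and at `4` as at `1`.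
  rcases hx : π (false, false) with ⟨_ | _, _ | _⟩
  · exact absurd hx h0
  · refine ⟨0, ?_⟩
    rw [hx] at h4
    rcases hy : π (true, false) with ⟨_ | _, _ | _⟩ <;> simp_all [turn]
  · refine ⟨2, ?_⟩
    rw [hx] at h4
    rcases hy : π (false, true) with ⟨_ | _, _ | _⟩ <;> simp_all [turn]
  · refine ⟨1, ?_⟩
    rw [hx] at h4
    rcases hy : π (false, true) with ⟨_ | _, _ | _⟩ <;> simp_all [turn]

end QState

/-! ### Open states at an edge, their types, and their behaviour under 2-sums and closing. -/

namespace QState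

variable {P E P' E' : Type u}

theorem joinPairs_le {F : Type*} {r m : Setoid P} {S : F → Prop} {p q : F → P} (h : r ≤ m)
    (hS : ∀ e, S e → m (p e) (q e)) : joinPairs r S p q ≤ m := by
  refine sup_le h (eqvGen_setoid_le ?_)
  rintro _ _ ⟨e, he, rfl, rfl⟩
  exact hS e he

theorem le_joinPairs {F : Type*} {r : Setoid P} {S : F → Prop} {p q : F → P} :
    r ≤ joinPairs r S p q := le_sup_left

theorem joinPairs_rel {F : Type*} {r : Setoid P} {S : F → Prop} {p q : F → P} {e : F} (he : S e) :
    joinPairs r S p q (p e) (q e) :=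
  (le_sup_right : _ ≤ joinPairs r S p q) (Relation.EqvGen.rel _ _ ⟨e, he, rfl, rfl⟩)

theorem turn_ne (o : Fin 5) (a : Bool × Bool) : turn o a ≠ a := by
  revert o a; decide

/-- The circles of a state. -/
def stateCircles (G : ArrowPresentation P E) (s : E → Fin 5) : Setoid P :=
  Relation.EqvGen.setoid (Step G s)

/-- The vertex classes of a state. -/
def stateClasses (G : VertexPartitioned P E) (s : E → Fin 5) : Setoid P :=
  joinPairs G.vcls (fun e => s e ≠ 0)
    (fun e => G.pt e (false, false)) (fun e => G.pt e (true, false))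

/-- The elementary steps when the edges other than `f` are in the state `s` and the segments
carrying the arrows of `f` are removed. -/
def OpenStep (G : ArrowPresentation P E) (f : E) (s : {g : E // g ≠ f} → Fin 5) (x y : P) : Prop :=
  y = G.gap x ∨ ((∀ e a, x ≠ G.pt e a) ∧ y = G.seg x) ∨
    ∃ g : {g : E // g ≠ f}, ∃ a, x = G.pt g.1 a ∧ y = G.pt g.1 (turn (s g) a)

/-- The circles and arcs of a state in which the arrows of `f` are removed. -/
def openCircles (G : ArrowPresentation P E) (f : E) (s : {g : E // g ≠ f} → Fin 5) : Setoid P :=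
  Relation.EqvGen.setoid (OpenStep G f s)

/-- The vertex classes of a state in which the arrows of `f` are removed. -/
def openClasses (G : VertexPartitioned P E) (f : E) (s : {g : E // g ≠ f} → Fin 5) : Setoid P :=
  joinPairs G.vcls (fun g : {g : E // g ≠ f} => s g ≠ 0)
    (fun g => G.pt g.1 (false, false)) (fun g => G.pt g.1 (true, false))

/-- This isolates the dependence on the operation at `f`: the open part does not see `s f`, which
only prescribes how the four ends are joined. -/
theorem stateCircles_eq (G : ArrowPresentation P E) (f : E) (s : E → Fin 5) :
    stateCircles G s = joinAlong (openCircles G f fun g => s g.1) (G.pt f)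
      (fun a b => b = turn (s f) a) := by
  apply le_antisymm
  · apply eqvGen_setoid_le
    rintro x y (rfl | h | ⟨g, a, rfl, rfl⟩)
    · exact le_joinAlong (Relation.EqvGen.rel _ _ (Or.inl rfl))
    · exact le_joinAlong (Relation.EqvGen.rel _ _ (Or.inr (Or.inl h)))
    · by_cases hg : g = f
      · subst hg
        exact joinAlong_rel (p := G.pt g) (i := a) rfl
      · exact le_joinAlong (Relation.EqvGen.rel _ _ (Or.inr (Or.inr ⟨⟨g, hg⟩, a, rfl, rfl⟩)))
  · refine joinAlong_le (eqvGen_setoid_le ?_) ?_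
    · rintro x y (rfl | h | ⟨g, a, rfl, rfl⟩)
      · exact Relation.EqvGen.rel _ _ (Or.inl rfl)
      · exact Relation.EqvGen.rel _ _ (Or.inr (Or.inl h))
      · exact Relation.EqvGen.rel _ _ (Or.inr (Or.inr ⟨g.1, a, rfl, rfl⟩))
    · rintro a _ rfl
      exact Relation.EqvGen.rel _ _ (Or.inr (Or.inr ⟨f, a, rfl, rfl⟩))

/-- The analogue for vertex classes. One index per arrow is enough, since the tail and the head of
an arrow lie on the same vertex. -/
theorem stateClasses_eq (G : VertexPartitioned P E) (f : E) (s : E → Fin 5) :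
    stateClasses G s = joinAlong (openClasses G f fun g => s g.1)
      (fun i => G.pt f (i, false)) (fun _ _ => s f ≠ 0) := by
  apply le_antisymm
  · refine joinPairs_le (fun _ _ h => le_joinAlong (le_joinPairs h)) fun g hg => ?_
    by_cases h : g = f
    · subst h
      exact joinAlong_rel (p := fun i => G.pt g (i, false)) hg
    · exact le_joinAlong
        (joinPairs_rel (S := fun g : {g : E // g ≠ f} => s g.1 ≠ 0) (e := ⟨g, h⟩) hg)
  · refine joinAlong_le (joinPairs_le le_joinPairs fun g hg => ?_) fun i j h => ?_
    · exact joinPairs_rel (S := fun g => s g ≠ 0) (e := g.1) hg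
    · have h1 : stateClasses G s (G.pt f (false, false)) (G.pt f (true, false)) :=
        joinPairs_rel (S := fun g => s g ≠ 0) h
      cases i <;> cases j
      exacts [Setoid.refl' _ _, h1, Setoid.symm' _ h1, Setoid.refl' _ _]

/-! ### The arcs ending at the arrows of an edge -/

/-- With the arrows of `f` removed, the components through the ends of `f` are arcs, each with two
of these ends; so the ends are paired. The facts about involutions apply to the gap map and to a
segment map that fixes exactly the ends of `f`. -/
theorem openCircles_pt_rel [Finite P] (G : ArrowPresentation P E) (f : E)
    (s : {g : E // g ≠ f} → Fin 5) :
    ∃ t : Fin 3, ∀ a b, openCircles G f s (G.pt f a) (G.pt f b) ↔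
      b = a ∨ b = turn (t.castLE (by decide)) a := by
  classical
  let k : E × (Bool × Bool) → P := fun x => G.pt x.1 x.2
  -- Leaving the ends of `f` fixed encodes them as ends of arcs; at every other edge `turn` has no
  -- fixed point.
  let τ : E × (Bool × Bool) → E × (Bool × Bool) := fun x =>
    if h : x.1 = f then x else (x.1, turn (s ⟨x.1, h⟩) x.2)
  have hk : Function.Injective k := fun x y h =>
    Prod.ext (G.pt_inj _ _ _ _ h).1 (G.pt_inj _ _ _ _ h).2
  have hτ : ∀ x, τ (τ x) = x := by
    rintro ⟨g, a⟩
    by_cases h : g = f <;> simp [τ, h, turn_turn]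
  have hτf : ∀ a, τ (f, a) = (f, a) := fun a => by simp [τ]
  have hτg : ∀ (g : {g : E // g ≠ f}) a, τ (g.1, a) = (g.1, turn (s g) a) := fun g a => by
    simp [τ, g.2]
  have hσ : ∀ x, reglue k τ G.seg (reglue k τ G.seg x) = x :=
    reglue_reglue hk hτ G.seg_seg fun x => ⟨(x.1, x.2.1, !x.2.2), G.seg_pt _ _ _⟩
  have hσf : ∀ x, reglue k τ G.seg x = x ↔ ∃ a, x = G.pt f a := by
    intro x
    constructor
    · intro h
      by_cases hx : ∃ y, k y = x
      · obtain ⟨⟨g, a⟩, rfl⟩ := hx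
        rw [reglue_apply hk] at h
        by_cases hg : g = f
        · exact ⟨a, by rw [hg]⟩
        · have h1 := hk h
          rw [hτg ⟨g, hg⟩] at h1
          exact absurd (Prod.ext_iff.1 h1).2 (turn_ne _ _)
      · push Not at hx
        rw [reglue_of_not x hx] at h
        exact absurd h (G.seg_ne x)
    · rintro ⟨a, rfl⟩
      exact (reglue_apply hk (f, a)).trans (by rw [hτf])
  let g := Function.Involutive.toPerm G.gap G.gap_gap
  let σ := Function.Involutive.toPerm _ hσ
  have hr : openCircles G f s = Relation.EqvGen.setoid (fun x y => y = g x ∨ y = σ x) := by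
    apply le_antisymm
    · apply eqvGen_setoid_le
      rintro x y (rfl | ⟨h, rfl⟩ | ⟨e, a, rfl, rfl⟩)
      · exact Relation.EqvGen.rel _ _ (Or.inl rfl)
      · exact Relation.EqvGen.rel _ _
          (Or.inr (reglue_of_not x fun y hy => h y.1 y.2 hy.symm).symm)
      · refine Relation.EqvGen.rel _ _ (Or.inr ?_)
        exact ((reglue_apply hk (e.1, a)).trans (by rw [hτg])).symm
    · apply eqvGen_setoid_le
      rintro x y (rfl | rfl)
      · exact Relation.EqvGen.rel _ _ (Or.inl rfl)
      · by_cases hx : ∃ y, k y = x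
        · obtain ⟨⟨e, a⟩, rfl⟩ := hx
          change openCircles G f s _ (reglue k τ G.seg _)
          rw [reglue_apply hk]
          by_cases he : e = f
          · subst he
            rw [hτf]
          · rw [hτg ⟨e, he⟩]
            exact Relation.EqvGen.rel _ _ (Or.inr (Or.inr ⟨⟨e, he⟩, a, rfl, rfl⟩))
        · push Not at hx
          exact Relation.EqvGen.rel _ _
            (Or.inr (Or.inl ⟨fun e a h => hx (e, a) h.symm, reglue_of_not x hx⟩))
  have hfix : ∀ a, σ (G.pt f a) = G.pt f a := fun a => (hσf _).2 ⟨a, rfl⟩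
  have hpartner : ∀ a, ∃ b, b ≠ a ∧ openCircles G f s (G.pt f a) (G.pt f b) := by
    intro a
    obtain ⟨y, hy, hya, hay⟩ := exists_fixed_ne (g := g) (s := σ) G.gap_gap G.gap_ne hσ (hfix a)
    obtain ⟨b, rfl⟩ := (hσf y).1 hy
    exact ⟨b, fun h => hya (by rw [h]), hr ▸ hay⟩
  have huniq : ∀ a b c, openCircles G f s (G.pt f a) (G.pt f b) →
      openCircles G f s (G.pt f a) (G.pt f c) → b ≠ a → c ≠ a → b = c := by
    intro a b c hab hac hb hc
    rw [hr] at hab hac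
    exact G.pt_injective f (eq_of_fixed (g := g) (s := σ) G.gap_gap hσ (hfix a) (hfix b) (hfix c)
      hab hac (fun h => hb (G.pt_injective f h)) (fun h => hc (G.pt_injective f h)))
  choose π hπ hπr using hpartner
  -- Both `a` and `π (π a)` are partners of `π a`, so uniqueness makes `π` an involution.
  obtain ⟨t, ht⟩ := exists_turn π hπ fun a =>
    huniq (π a) _ _ (hπr _) (Setoid.symm' _ (hπr a)) (hπ _) (hπ a).symm
  refine ⟨t, fun a b => ?_⟩
  rw [← ht]
  constructor
  · intro h
    by_cases hb : b = a
    · exact Or.inl hb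
    · exact Or.inr (huniq a _ _ h (hπr a) hb (hπ a))
  · rintro (rfl | rfl)
    · exact Setoid.refl' _ _
    · exact hπr a

/-- Deletion follows the old segments. Every other operation merges the classes of the two arrows,
so all four ends then share a class, however they are joined. -/
theorem openCircles_le_openClasses (G : VertexPartitioned P E) (f : E)
    (s : {g : E // g ≠ f} → Fin 5) :
    openCircles G.toArrowPresentation f s ≤ openClasses G f s := by
  have hseg : ∀ x, openClasses G f s x (G.seg x) := fun x =>
    le_joinPairs (G.circles_le (G.circles_seg x))
  apply eqvGen_setoid_le
  rintro x y (rfl | ⟨h, rfl⟩ | ⟨g, a, rfl, rfl⟩)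
  · exact le_joinPairs (G.circles_le (G.circles_gap x))
  · exact hseg x
  · have h0 : turn 0 a = (a.1, !a.2) := rfl
    by_cases hg : s g = 0
    · rw [hg, h0, ← G.seg_pt]
      exact hseg _
    · have h1 : openClasses G f s (G.pt g.1 (false, false)) (G.pt g.1 (true, false)) :=
        joinPairs_rel (S := fun g => s g ≠ 0) hg
      have h2 : ∀ i, openClasses G f s (G.pt g.1 (i, false)) (G.pt g.1 (i, true)) := fun i => by
        have := hseg (G.pt g.1 (i, false))
        rwa [G.seg_pt] at this
      have h3 : ∀ a, openClasses G f s (G.pt g.1 (false, false)) (G.pt g.1 a) := by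
        rintro ⟨_ | _, _ | _⟩
        exacts [Setoid.refl' _ _, h2 _, h1, Setoid.trans' _ h1 (h2 _)]
      exact Setoid.trans' _ (Setoid.symm' _ (h3 a)) (h3 _)

/-- The type of a state: the operation at `f` that its arcs and classes at `f` amount to. -/
theorem exists_stateType [Finite P] (G : VertexPartitioned P E) (f : E)
    (s : {g : E // g ≠ f} → Fin 5) :
    ∃ t : Fin 5, (∀ a b, openCircles G.toArrowPresentation f s (G.pt f a) (G.pt f b) ↔
      b = a ∨ b = turn t a) ∧
      (∀ i j, openClasses G f s (G.pt f (i, false)) (G.pt f (j, false)) ↔ i = j ∨ t ≠ 0) ∧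
      t ≠ 4 := by
  obtain ⟨t, ht⟩ := openCircles_pt_rel G.toArrowPresentation f s
  have hall : openClasses G f s (G.pt f (false, false)) (G.pt f (true, false)) → ∀ i j,
      openClasses G f s (G.pt f (i, false)) (G.pt f (j, false)) := by
    intro h i j
    cases i <;> cases j
    exacts [Setoid.refl' _ _, h, Setoid.symm' _ h, Setoid.refl' _ _]
  have hseg : ∀ i, openClasses G f s (G.pt f (i, false)) (G.pt f (i, true)) := fun i => by
    have : openClasses G f s _ _ := le_joinPairs (G.circles_le (G.circles_seg (G.pt f (i, false))))
    rwa [G.seg_pt] at this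
  have hle := openCircles_le_openClasses G f s
  -- Merging separates type `3` from type `0`, which have the same pairing.
  by_cases h : openClasses G f s (G.pt f (false, false)) (G.pt f (true, false))
  · by_cases h0 : t = 0
    · subst h0
      exact ⟨3, ht, fun i j => iff_of_true (hall h i j) (Or.inr (by decide)), by decide⟩
    · refine ⟨_, ht, fun i j => iff_of_true (hall h i j) (Or.inr ?_), ?_⟩ <;>
        clear ht <;> revert t <;> decide
  · have h0 : t = 0 := by
      by_contra h0
      -- In the pairings `1` and `2` an arc runs from one arrow of `f` to the other, so their
      -- classes would coincide.
      have h1 := hle ((ht (false, false) _).2 (Or.inr rfl))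
      apply h
      obtain rfl | rfl : t = 1 ∨ t = 2 := by
        clear ht h1
        revert t
        decide
      · exact Setoid.trans' _ h1 (Setoid.symm' _ (hseg true))
      · exact h1
    subst h0
    refine ⟨0, ht, fun i j => ?_, by decide⟩
    have h' : ¬ openClasses G f s (G.pt f (true, false)) (G.pt f (false, false)) :=
      fun h1 => h (Setoid.symm' _ h1)
    cases i <;> cases j <;> simp [h, h']

/-- The type of a state of the edges other than `f`. -/
noncomputable def stateType [Finite P] (G : VertexPartitioned P E) (f : E)
    (s : {g : E // g ≠ f} → Fin 5) : Fin 5 :=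
  (exists_stateType G f s).choose

theorem openCircles_pt [Finite P] (G : VertexPartitioned P E) (f : E)
    (s : {g : E // g ≠ f} → Fin 5) (a b : Bool × Bool) :
    openCircles G.toArrowPresentation f s (G.pt f a) (G.pt f b) ↔
      b = a ∨ b = turn (stateType G f s) a :=
  (exists_stateType G f s).choose_spec.1 a b

theorem openClasses_pt [Finite P] (G : VertexPartitioned P E) (f : E)
    (s : {g : E // g ≠ f} → Fin 5) (i j : Bool) :
    openClasses G f s (G.pt f (i, false)) (G.pt f (j, false)) ↔ i = j ∨ stateType G f s ≠ 0 :=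
  (exists_stateType G f s).choose_spec.2.1 i j

theorem stateType_ne [Finite P] (G : VertexPartitioned P E) (f : E)
    (s : {g : E // g ≠ f} → Fin 5) : stateType G f s ≠ 4 :=
  (exists_stateType G f s).choose_spec.2.2

/-- Extend a state of the edges other than `f` by the operation `o` at `f`. -/
def extendState [DecidableEq E] {f : E} (s : {g : E // g ≠ f} → Fin 5) (o : Fin 5) : E → Fin 5 :=
  (Equiv.funSplitAt f (Fin 5)).symm (o, s)

theorem extendState_self [DecidableEq E] {f : E} (s : {g : E // g ≠ f} → Fin 5) (o : Fin 5) :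
    extendState s o f = o := by
  simp [extendState, Equiv.funSplitAt]

theorem extendState_val [DecidableEq E] {f : E} (s : {g : E // g ≠ f} → Fin 5) (o : Fin 5)
    (g : {g : E // g ≠ f}) : extendState s o g.1 = s g := by
  simp [extendState, Equiv.funSplitAt, g.2]

theorem stateCircles_extendState [DecidableEq E] (G : ArrowPresentation P E) {f : E}
    (s : {g : E // g ≠ f} → Fin 5) (o : Fin 5) :
    stateCircles G (extendState s o) =
      joinAlong (openCircles G f s) (G.pt f) (fun a b => b = turn o a) := by
  rw [stateCircles_eq G f]
  simp only [extendState_val, extendState_self]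

theorem stateClasses_extendState [DecidableEq E] (G : VertexPartitioned P E) {f : E}
    (s : {g : E // g ≠ f} → Fin 5) (o : Fin 5) :
    stateClasses G (extendState s o) =
      joinAlong (openClasses G f s) (fun i => G.pt f (i, false)) (fun _ _ => o ≠ 0) := by
  rw [stateClasses_eq G f]
  simp only [extendState_val, extendState_self]

/-! ### States of a 2-sum -/

/-- A curve crosses from one summand to the other only at the four identified pairs of ends.
Indexing these by the ends of `e` puts `φ.symm` on the side of `G`. -/
theorem stateCircles_twoSum (G : ArrowPresentation P E) (f : E) (H : ArrowPresentation P' E')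
    (e : E') (φ : Coupling) (s : {g : E // g ≠ f} ⊕ {g : E' // g ≠ e} → Fin 5) :
    stateCircles (G.twoSum f H e φ) s =
      glueSetoid (openCircles G f (s ∘ Sum.inl)) (openCircles H e (s ∘ Sum.inr))
        (fun a => G.pt f (φ.symm a.1, a.2)) (H.pt e) := by
  set p : Bool × Bool → P := fun a => G.pt f (φ.symm a.1, a.2) with hp
  have hinj := ArrowPresentation.sumEnds_injective G f H e
  have hsegl : ∀ a, (G.twoSum f H e φ).seg (Sum.inl (G.pt f a)) = Sum.inr (H.pt e (φ a.1, a.2)) :=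
    fun a => reglue_apply hinj (Sum.inl a)
  have hsegr : ∀ a, (G.twoSum f H e φ).seg (Sum.inr (H.pt e a)) = Sum.inl (p a) :=
    fun a => reglue_apply hinj (Sum.inr a)
  have hglue : ∀ {r : Setoid P} {r' : Setoid P'} (a : Bool × Bool),
      glueSetoid r r' p (H.pt e) (Sum.inl (G.pt f a)) (Sum.inr (H.pt e (φ a.1, a.2))) := by
    intro r r' a
    have := glueSetoid_glue (r := r) (r' := r') (p := p) (q := H.pt e) (φ a.1, a.2)
    simpa [hp] using this
  have hseg : ∀ x, (∀ a, ArrowPresentation.sumEnds G f H e a ≠ x) →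
      (G.twoSum f H e φ).seg x = Sum.map G.seg H.seg x := fun x hx => reglue_of_not x hx
  apply le_antisymm
  · apply eqvGen_setoid_le
    rintro x y (rfl | ⟨h, rfl⟩ | ⟨g, a, rfl, rfl⟩)
    · rcases x with x | x
      · exact glueSetoid_left (Relation.EqvGen.rel _ _ (Or.inl rfl))
      · exact glueSetoid_right (Relation.EqvGen.rel _ _ (Or.inl rfl))
    · by_cases hx : ∃ a, ArrowPresentation.sumEnds G f H e a = x
      · obtain ⟨a | a, rfl⟩ := hx
        · change glueSetoid _ _ _ _ (Sum.inl (G.pt f a))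
            ((G.twoSum f H e φ).seg (Sum.inl (G.pt f a)))
          rw [hsegl]
          exact hglue a
        · change glueSetoid _ _ _ _ (Sum.inr (H.pt e a))
            ((G.twoSum f H e φ).seg (Sum.inr (H.pt e a)))
          rw [hsegr]
          exact Setoid.symm' _ (glueSetoid_glue a)
      · push Not at hx
        rw [hseg x hx]
        rcases x with x | x
        · refine glueSetoid_left (Relation.EqvGen.rel _ _ (Or.inr (Or.inl ⟨?_, rfl⟩)))
          rintro g a rfl
          by_cases hg : g = f
          · subst hg
            exact hx (Sum.inl a) rfl
          · exact h (Sum.inl ⟨g, hg⟩) a rfl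
        · refine glueSetoid_right (Relation.EqvGen.rel _ _ (Or.inr (Or.inl ⟨?_, rfl⟩)))
          rintro g a rfl
          by_cases hg : g = e
          · subst hg
            exact hx (Sum.inr a) rfl
          · exact h (Sum.inr ⟨g, hg⟩) a rfl
    · rcases g with g | g
      · exact glueSetoid_left (Relation.EqvGen.rel _ _ (Or.inr (Or.inr ⟨g, a, rfl, rfl⟩)))
      · exact glueSetoid_right (Relation.EqvGen.rel _ _ (Or.inr (Or.inr ⟨g, a, rfl, rfl⟩)))
  · refine glueSetoid_le ?_ ?_ ?_
    · suffices h : openCircles G f (s ∘ Sum.inl) ≤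
          Setoid.comap Sum.inl (stateCircles (G.twoSum f H e φ) s) from fun x y h' => h h'
      apply eqvGen_setoid_le
      rintro x y (rfl | ⟨h, rfl⟩ | ⟨g, a, rfl, rfl⟩)
      · exact Relation.EqvGen.rel _ _ (Or.inl rfl)
      · refine Relation.EqvGen.rel _ _ (Or.inr (Or.inl ⟨?_, (hseg (Sum.inl x) ?_).symm⟩))
        · rintro (g | g) a hg
          · exact h _ _ (Sum.inl.inj hg)
          · cases hg
        · rintro (a | a) ha
          · exact h _ _ (Sum.inl.inj ha).symm
          · cases ha
      · exact Relation.EqvGen.rel _ _ (Or.inr (Or.inr ⟨Sum.inl g, a, rfl, rfl⟩))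
    · suffices h : openCircles H e (s ∘ Sum.inr) ≤
          Setoid.comap Sum.inr (stateCircles (G.twoSum f H e φ) s) from fun x y h' => h h'
      apply eqvGen_setoid_le
      rintro x y (rfl | ⟨h, rfl⟩ | ⟨g, a, rfl, rfl⟩)
      · exact Relation.EqvGen.rel _ _ (Or.inl rfl)
      · refine Relation.EqvGen.rel _ _ (Or.inr (Or.inl ⟨?_, (hseg (Sum.inr x) ?_).symm⟩))
        · rintro (g | g) a hg
          · cases hg
          · exact h _ _ (Sum.inr.inj hg)
        · rintro (a | a) ha
          · cases ha
          · exact h _ _ (Sum.inr.inj ha).symm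
      · exact Relation.EqvGen.rel _ _ (Or.inr (Or.inr ⟨Sum.inr g, a, rfl, rfl⟩))
    · intro a
      -- The joining segments carry no arrow of the 2-sum, so they are traversed in every state.
      refine Setoid.symm' _ (Relation.EqvGen.rel _ _ (Or.inr (Or.inl ⟨?_, (hsegr a).symm⟩)))
      rintro (g | g) b hg
      · cases hg
      · exact g.2 (H.pt_inj _ _ _ _ (Sum.inr.inj hg)).1.symm

theorem stateClasses_twoSum (G : VertexPartitioned P E) (f : E) (H : VertexPartitioned P' E')
    (e : E') (φ : Coupling) (s : {g : E // g ≠ f} ⊕ {g : E' // g ≠ e} → Fin 5) :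
    stateClasses (G.twoSum f H e φ) s =
      glueSetoid (openClasses G f (s ∘ Sum.inl)) (openClasses H e (s ∘ Sum.inr))
        (fun i => G.pt f (φ.symm i, false)) (fun i => H.pt e (i, false)) := by
  apply le_antisymm
  · refine joinPairs_le (eqvGen_setoid_le ?_) ?_
    · rintro _ _ (h | h | i)
      · exact glueSetoid_left (le_joinPairs h)
      · exact glueSetoid_right (le_joinPairs h)
      · have := glueSetoid_glue (r := openClasses G f (s ∘ Sum.inl))
          (r' := openClasses H e (s ∘ Sum.inr)) (p := fun i => G.pt f (φ.symm i, false))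
          (q := fun i => H.pt e (i, false)) (φ i)
        simpa using this
    · rintro (g | g) hg
      · exact glueSetoid_left (joinPairs_rel (S := fun g => (s ∘ Sum.inl) g ≠ 0) hg)
      · exact glueSetoid_right (joinPairs_rel (S := fun g => (s ∘ Sum.inr) g ≠ 0) hg)
  · refine glueSetoid_le ?_ ?_ ?_
    · suffices h : openClasses G f (s ∘ Sum.inl) ≤
          Setoid.comap Sum.inl (stateClasses (G.twoSum f H e φ) s) from fun x y h' => h h'
      refine joinPairs_le (fun x y h => le_joinPairs (Relation.EqvGen.rel _ _ (.left h)))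
        fun g hg => ?_
      exact joinPairs_rel (S := fun g => s g ≠ 0) (e := Sum.inl g) hg
    · suffices h : openClasses H e (s ∘ Sum.inr) ≤
          Setoid.comap Sum.inr (stateClasses (G.twoSum f H e φ) s) from fun x y h' => h h'
      refine joinPairs_le (fun x y h => le_joinPairs (Relation.EqvGen.rel _ _ (.right h)))
        fun g hg => ?_
      exact joinPairs_rel (S := fun g => s g ≠ 0) (e := Sum.inr g) hg
    · intro i
      have := VertexPartitioned.SumStep.glue (G := G) (f := f) (H := H) (e := e) (φ := φ)
        (φ.symm i)
      rw [Equiv.apply_symm_apply] at this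
      exact le_joinPairs (Relation.EqvGen.rel _ _ this)

/-- A coupling is the identity or the swap of the two arrows, and every `turn o` commutes with both.
This is why the choice of couplings does not affect the result. -/
theorem turn_coupling (φ : Coupling) (o : Fin 5) (a : Bool × Bool) :
    turn o (φ a.1, a.2) = (φ (turn o a).1, (turn o a).2) := by
  revert φ o a; decide

/-- The number of circles of a state that avoid `f`. -/
noncomputable def freeCircles (G : ArrowPresentation P E) (f : E)
    (s : {g : E // g ≠ f} → Fin 5) : ℕ :=
  numFree (openCircles G f s) (G.pt f)

/-- The number of vertex classes of a state that avoid `f`. -/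
noncomputable def freeClasses (G : VertexPartitioned P E) (f : E)
    (s : {g : E // g ≠ f} → Fin 5) : ℕ :=
  numFree (openClasses G f s) (fun i => G.pt f (i, false))

/-- The open state of `H` joins the ends of `f` by the pairing of its type, exactly as that
operation at `f` would; `turn_coupling` removes `φ`. -/
theorem card_stateCircles_twoSum [Finite P] [Finite P'] [DecidableEq E]
    (G : VertexPartitioned P E) (f : E) (H : VertexPartitioned P' E')
    (e : E') (φ : Coupling) (s : {g : E // g ≠ f} → Fin 5) (s' : {g : E' // g ≠ e} → Fin 5) :
    Nat.card (Quotient (stateCircles (G.twoSum f H e φ).toArrowPresentation (Sum.elim s s'))) =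
      Nat.card (Quotient (stateCircles G.toArrowPresentation
        (extendState s (stateType H e s')))) + freeCircles H.toArrowPresentation e s' := by
  change Nat.card (Quotient (stateCircles (G.toArrowPresentation.twoSum f
    H.toArrowPresentation e φ) (Sum.elim s s'))) = _
  rw [stateCircles_twoSum, card_glueSetoid, stateCircles_extendState, freeCircles]
  simp only [Sum.elim_comp_inl, Sum.elim_comp_inr, openCircles_pt]
  congr 3
  apply le_antisymm
  · refine joinAlong_le le_joinAlong ?_
    rintro a b (rfl | rfl)
    · exact Setoid.refl' _ _
    · refine joinAlong_rel (p := G.pt f) (i := (φ.symm a.1, a.2)) ?_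
      exact (turn_coupling φ.symm _ a).symm
  · refine joinAlong_le le_joinAlong ?_
    rintro a _ rfl
    have := joinAlong_rel (r := openCircles G.toArrowPresentation f s)
      (p := fun a : Bool × Bool => G.pt f (φ.symm a.1, a.2))
      (R := fun a b => b = a ∨ b = turn (stateType H e s') a) (i := (φ a.1, a.2)) (Or.inr rfl)
    simpa [turn_coupling] using this

theorem card_stateClasses_twoSum [Finite P] [Finite P'] [DecidableEq E]
    (G : VertexPartitioned P E) (f : E) (H : VertexPartitioned P' E')
    (e : E') (φ : Coupling) (s : {g : E // g ≠ f} → Fin 5) (s' : {g : E' // g ≠ e} → Fin 5) :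
    Nat.card (Quotient (stateClasses (G.twoSum f H e φ) (Sum.elim s s'))) =
      Nat.card (Quotient (stateClasses G
        (extendState s (stateType H e s')))) + freeClasses H e s' := by
  rw [stateClasses_twoSum, card_glueSetoid, stateClasses_extendState, freeClasses]
  simp only [Sum.elim_comp_inl, Sum.elim_comp_inr, openClasses_pt]
  congr 3
  apply le_antisymm
  · refine joinAlong_le le_joinAlong ?_
    rintro i j (rfl | h)
    · exact Setoid.refl' _ _
    · exact joinAlong_rel (p := fun i => G.pt f (i, false)) h
  · refine joinAlong_le le_joinAlong fun i j h => ?_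
    have := joinAlong_rel (r := openClasses G f s)
      (p := fun i : Bool => G.pt f (φ.symm i, false))
      (R := fun i j => i = j ∨ stateType H e s' ≠ 0) (i := φ i) (j := φ j) (Or.inr h)
    simpa using this

/-! ### States in which the operation at an edge is prescribed -/

/-- A function whose fibres are the pairs of ends joined by `turn t`. -/
def turnInvariant (t : Fin 5) (a : Bool × Bool) : Bool :=
  ![a.1, a.1 ^^ a.2, a.2, a.1, a.1 ^^ a.2] t

theorem turnInvariant_surjective (t : Fin 5) : Function.Surjective (turnInvariant t) := by
  revert t; decide

theorem turnInvariant_eq_iff (t : Fin 5) (a b : Bool × Bool) :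
    (b = a ∨ b = turn t a) ↔ turnInvariant t a = turnInvariant t b := by
  revert t a b; decide

/-- Two different pairings of four points together connect all of them. -/
theorem eq_or_eq_turn (o t : Fin 5) (h : ¬ ∀ a, turn o a = turn t a) (a b : Bool × Bool) :
    b = a ∨ b = turn o a ∨ b = turn t a ∨ b = turn t (turn o a) := by
  revert o t a b; decide

/-- Equal pairings close the two arcs into two circles; different ones string them together into
one. This accounts for the powers of `α` in the matrix. -/
theorem card_stateCircles_extendState [Finite P] [DecidableEq E] (G : VertexPartitioned P E) (f : E)
    (s : {g : E // g ≠ f} → Fin 5) (o : Fin 5) :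
    Nat.card (Quotient (stateCircles G.toArrowPresentation (extendState s o))) =
      (if ∀ a, turn o a = turn (stateType G f s) a then 2 else 1) +
        freeCircles G.toArrowPresentation f s := by
  rw [stateCircles_extendState, card_joinAlong, freeCircles]
  congr 1
  have hcomap : ∀ a b, Setoid.comap (G.pt f) (openCircles G.toArrowPresentation f s) a b ↔
      b = a ∨ b = turn (stateType G f s) a := openCircles_pt G f s
  set r := Setoid.comap (G.pt f) (openCircles G.toArrowPresentation f s)
  set m := r ⊔ Relation.EqvGen.setoid (fun a b => b = turn o a)
  have hr : ∀ a, m a (turn (stateType G f s) a) := fun a =>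
    (le_sup_left : r ≤ m) ((hcomap _ _).2 (Or.inr rfl))
  have ho : ∀ a, m a (turn o a) := fun a =>
    (le_sup_right : _ ≤ m) (Relation.EqvGen.rel _ _ rfl)
  generalize stateType G f s = t at *
  split_ifs with h
  · rw [card_quotient_of_surjective m (turnInvariant t) (turnInvariant_surjective t)]
    · simp
    · suffices h' : m ≤ Setoid.ker (turnInvariant t) from fun x y h => h' h
      refine sup_le (fun a b hab => ?_) (eqvGen_setoid_le fun a b hab => ?_)
      · exact (turnInvariant_eq_iff t a b).1 ((hcomap a b).1 hab)
      · exact (turnInvariant_eq_iff t a b).1 (Or.inr (by rw [hab, h]))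
    · intro a b hab
      rcases (turnInvariant_eq_iff t a b).2 hab with rfl | rfl
      · exact Setoid.refl' _ _
      · exact hr a
  · rw [card_quotient_of_surjective m (fun _ => ()) (fun _ => ⟨(true, true), rfl⟩)
      (fun _ _ _ => rfl)]
    · simp
    · intro a b _
      rcases eq_or_eq_turn o t h a b with rfl | rfl | rfl | rfl
      exacts [Setoid.refl' _ _, ho _, hr _, Setoid.trans' _ (ho _) (hr _)]

/-- The two arrows stay in different classes only if neither the open state nor the operation merges
them. This accounts for the powers of `β` in the matrix. -/
theorem card_stateClasses_extendState [Finite P] [DecidableEq E] (G : VertexPartitioned P E) (f : E)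
    (s : {g : E // g ≠ f} → Fin 5) (o : Fin 5) :
    Nat.card (Quotient (stateClasses G (extendState s o))) =
      (if o = 0 ∧ stateType G f s = 0 then 2 else 1) + freeClasses G f s := by
  rw [stateClasses_extendState, card_joinAlong, freeClasses]
  congr 1
  have hcomap : ∀ i j, Setoid.comap (fun i => G.pt f (i, false)) (openClasses G f s) i j ↔
      i = j ∨ stateType G f s ≠ 0 := openClasses_pt G f s
  set r := Setoid.comap (fun i => G.pt f (i, false)) (openClasses G f s)
  set m := r ⊔ Relation.EqvGen.setoid (fun _ _ => o ≠ 0)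
  split_ifs with h
  · rw [card_quotient_of_surjective m id Function.surjective_id]
    · simp
    · suffices h' : m ≤ Setoid.ker id from fun x y h => h' h
      refine sup_le (fun i j hij => ?_) (eqvGen_setoid_le fun i j hij => absurd h.1 hij)
      exact ((hcomap i j).1 hij).resolve_right (not_not.2 h.2)
    · rintro i _ rfl
      exact Setoid.refl' _ _
  · rw [card_quotient_of_surjective m (fun _ => ()) (fun _ => ⟨true, rfl⟩)
      (fun _ _ _ => rfl)]
    · simp
    · intro i j _
      by_cases ho : o = 0
      · exact (le_sup_left : r ≤ m) ((hcomap i j).2 (Or.inr fun ht => h ⟨ho, ht⟩))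
      · exact (le_sup_right : _ ≤ m) (Relation.EqvGen.rel _ _ ho)

end QState

/-! ### State sums with edge-dependent weights. -/

namespace QState

variable {P E P' E' : Type u} {R : Type*} [CommRing R]

/-- The monomial of `α` and `β` contributed by a state. -/
noncomputable def stateValue (G : VertexPartitioned P E) (s : E → Fin 5) (α β : R) : R :=
  α ^ Nat.card (Quotient (stateCircles G.toArrowPresentation s)) *
    β ^ Nat.card (Quotient (stateClasses G s))

open Classical in
/-- The state sum in which the operation `o` at the edge `e` has the weight `w e o`. -/
noncomputable def weightedSum [Finite E] (G : VertexPartitioned P E) (w : E → Fin 5 → R)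
    (α β : R) : R :=
  letI := Fintype.ofFinite E
  ∑ s : E → Fin 5, (∏ e, w e (s e)) * stateValue G s α β

theorem weightedSum_eq [Fintype E] [DecidableEq E] (G : VertexPartitioned P E)
    (w : E → Fin 5 → R) (α β : R) :
    weightedSum G w α β = ∑ s : E → Fin 5, (∏ e, w e (s e)) * stateValue G s α β := by
  unfold weightedSum
  congr!

theorem aeval_mono (G : Packaged P E) (s : E → Fin 5) (a b c x y α β : R) :
    MvPolynomial.aeval ![a, b, c, x, y, α, β, 1] (mono G s) =
      stateValue G.toVertexPartitioned s α β := by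
  simp [mono, stateValue, stateCircles, stateClasses]

theorem aeval_weight (a b c x y α β γ : R) (o : Fin 5) :
    MvPolynomial.aeval ![a, b, c, x, y, α, β, γ] (weight o) = ![a, b, c, x, y] o := by
  fin_cases o <;> simp [weight]

theorem Qval_eq_weightedSum [Finite P] [Finite E] (G : Packaged P E) (a b c x α β : R) :
    G.Qval a b c x 0 α β 1 =
      weightedSum G.toVertexPartitioned (fun _ => ![a, b, c, x, 0]) α β := by
  classical
  have hQ := existsUnique_isQ.choose_spec.1.unique isQ_stateSum
  unfold Packaged.Qval Packaged.Q
  rw [hQ]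
  simp only [stateSum, map_sum, map_mul, map_prod, aeval_mono, aeval_weight]
  rfl

theorem Qhat_eq_weightedSum [Finite P] [Finite E] (G : VertexPartitioned P E) (a b c x α β : R) :
    G.Qhat a b c x α β = weightedSum G (fun _ => ![a, b, c, x, 0]) α β :=
  Qval_eq_weightedSum G.toPackaged a b c x α β

theorem stateValue_op [DecidableEq E] (G : Packaged P E) (e : E) (s : {g : E // g ≠ e} → Fin 5)
    (o : Fin 5) (α β : R) :
    stateValue (op G e o).toVertexPartitioned s α β =
      stateValue G.toVertexPartitioned (extendState s o) α β := by
  -- The monomial of a state involves only `α`, `β` and `γ`, so the zeros are arbitrary; setting `γ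
  -- = 1` discards the boundary classes.
  have h := congrArg (MvPolynomial.aeval ![(0 : R), 0, 0, 0, 0, α, β, 1])
    (mono_op G e (extendState s o))
  rw [aeval_mono, aeval_mono] at h
  simpa only [extendState_self, extendState_val] using h

/-- The contribution of the states of type `t` when the edge `e` is removed. -/
noncomputable def typeSum [Finite P] [Finite E] (G : VertexPartitioned P E) (e : E)
    (w : {g : E // g ≠ e} → Fin 5 → R) (α β : R) (t : Fin 5) : R :=
  open Classical in
  letI := Fintype.ofFinite {g : E // g ≠ e}
  ∑ s : {g : E // g ≠ e} → Fin 5, if stateType G e s = t then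
    (∏ g, w g (s g)) * (α ^ freeCircles G.toArrowPresentation e s * β ^ freeClasses G e s) else 0

/-- Consequently the weights passed on to `G` again have no merge-contraction term, so the family of
polynomials `Qhat` is closed under this substitution. -/
theorem typeSum_four [Finite P] [Finite E] (G : VertexPartitioned P E) (e : E)
    (w : {g : E // g ≠ e} → Fin 5 → R) (α β : R) : typeSum G e w α β 4 = 0 :=
  Finset.sum_eq_zero fun s _ => if_neg (stateType_ne G e s)

/-- A state sum over a 2-sum is a state sum over the first summand. -/
theorem weightedSum_twoSum [Finite P] [Finite E] [Finite P'] [Finite E']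
    (G : VertexPartitioned P E) (f : E) (H : VertexPartitioned P' E') (e : E') (φ : Coupling)
    (v : E → Fin 5 → R) (w : {g : E' // g ≠ e} → Fin 5 → R) (α β : R)
    (hv : v f = typeSum H e w α β) :
    weightedSum (G.twoSum f H e φ) (Sum.elim (fun g => v g.1) w) α β = weightedSum G v α β := by
  classical
  let _ : Fintype E := Fintype.ofFinite E
  let _ : Fintype {g : E' // g ≠ e} := Fintype.ofFinite _
  rw [weightedSum_eq, weightedSum_eq, ← Equiv.sum_comp (Equiv.funSplitAt f (Fin 5)).symm,
    Fintype.sum_prod_type,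
    ← Equiv.sum_comp (Equiv.sumArrowEquivProdArrow _ _ _).symm, Fintype.sum_prod_type,
    Finset.sum_comm]
  conv_rhs => rw [Finset.sum_comm]
  rw [Finset.sum_comm]
  refine Finset.sum_congr rfl fun s _ => ?_
  -- The weight at `f` is itself a sum over open states of `H`, so a state of `G` expands into the
  -- pairs whose second member has the type prescribed at `f`.
  have hR : ∀ o, (∏ g, v g ((Equiv.funSplitAt f (Fin 5)).symm (o, s) g)) *
      stateValue G ((Equiv.funSplitAt f (Fin 5)).symm (o, s)) α β =
      ∑ s', if stateType H e s' = o then (∏ g, w g (s' g)) *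
        (α ^ freeCircles H.toArrowPresentation e s' * β ^ freeClasses H e s') *
        ((∏ g : {g : E // g ≠ f}, v g.1 (s g)) * stateValue G (extendState s o) α β) else 0 := by
    intro o
    change (∏ g, v g (extendState s o g)) * stateValue G (extendState s o) α β = _
    rw [Fintype.prod_eq_mul_prod_subtype_ne _ f, extendState_self, hv, typeSum]
    simp only [extendState_val]
    rw [mul_assoc, Finset.sum_mul]
    refine Finset.sum_congr (by congr!) fun s' _ => ?_
    rw [ite_mul, zero_mul]
  simp only [hR]
  rw [Finset.sum_comm]
  refine Finset.sum_congr rfl fun s' _ => ?_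
  -- For fixed `s'` only the operation equal to its type survives at `f`.
  rw [Finset.sum_ite_eq, if_pos (Finset.mem_univ _)]
  change (∏ g, _) * stateValue (G.twoSum f H e φ) (Sum.elim s s') α β = _
  rw [Fintype.prod_sum_type, stateValue, card_stateCircles_twoSum, card_stateClasses_twoSum,
    stateValue, pow_add, pow_add]
  simp only [Sum.elim_inl, Sum.elim_inr, Equiv.sumArrowEquivProdArrow_symm_apply_inl,
    Equiv.sumArrowEquivProdArrow_symm_apply_inr]
  ring

/-- Weights varying with the edge make the induction possible: edges still to be replaced carry the
type sums, while edges from copies of `H` already inserted carry `w`. -/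
theorem weightedSum_iteratedTwoSum [Finite P'] [Finite E'] (H : VertexPartitioned P' E') (e : E')
    (w : Fin 5 → R) (α β : R) (n : ℕ) {P E : Type u} [Finite P] [Finite E]
    (G : VertexPartitioned P E) (f : Fin n ↪ E) (φ : Fin n → Coupling) (v : E → Fin 5 → R)
    (hv : ∀ i, v (f i) = typeSum H e (fun _ => w) α β) (hv' : ∀ g ∉ Set.range f, v g = w) :
    weightedSum (iteratedTwoSum H e n G f φ).pres (fun _ => w) α β = weightedSum G v α β := by
  induction n generalizing P E with
  | zero =>
    have : v = fun _ => w := funext fun g => hv' g (by simp)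
    rw [this]
    rfl
  | succ n ih =>
    rw [← weightedSum_twoSum G (f 0) H e (φ 0) v (fun _ => w) α β (hv 0)]
    refine ih (G.twoSum (f 0) H e (φ 0)) (nextEdges f) (fun i => φ i.succ) _ (fun i => hv i.succ) ?_
    rintro (g | g) hg
    · refine hv' g.1 ?_
      rintro ⟨i, hi⟩
      obtain rfl | ⟨i, rfl⟩ := i.eq_zero_or_eq_succ
      · exact g.2 hi.symm
      · exact hg ⟨i, congrArg Sum.inl (Subtype.ext hi)⟩
    · rfl

theorem Qhat_tensor [Finite P] [Finite E] [Finite P'] [Finite E']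
    (G : VertexPartitioned P E) (H : VertexPartitioned P' E') (e : E') (φ : E → Coupling)
    {n : ℕ} (o : Fin n ≃ E) (a b c x α β : R) :
    (tensor G H e φ o).pres.Qhat a b c x α β =
      weightedSum G (fun _ => typeSum H e (fun _ => ![a, b, c, x, 0]) α β) α β := by
  rw [Qhat_eq_weightedSum]
  exact weightedSum_iteratedTwoSum H e _ α β n G o.toEmbedding _ _ (fun _ => rfl)
    fun g hg => absurd ⟨o.symm g, o.apply_symm_apply g⟩ hg

/-- Performing the operation `o` at the edge `e`, expanded over the types of the states. -/
theorem Qhat_op [Finite P] [Finite E] (G : VertexPartitioned P E) (e : E) (o : Fin 5)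
    (a b c x α β : R) :
    (op G.toPackaged e o).toVertexPartitioned.Qhat a b c x α β =
      ∑ t, (α ^ (if ∀ a, turn o a = turn t a then 2 else 1) *
        β ^ (if o = 0 ∧ t = 0 then 2 else 1)) *
          typeSum G e (fun _ => ![a, b, c, x, 0]) α β t := by
  classical
  let _ : Fintype {g : E // g ≠ e} := Fintype.ofFinite _
  rw [Qhat_eq_weightedSum, weightedSum_eq]
  simp only [typeSum, Finset.mul_sum, mul_ite, mul_zero]
  rw [Finset.sum_comm]
  refine Finset.sum_congr (by congr!) fun s _ => ?_
  rw [Finset.sum_ite_eq, if_pos (Finset.mem_univ _), stateValue_op, stateValue]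
  change _ * (α ^ Nat.card (Quotient (stateCircles G.toArrowPresentation (extendState s o))) *
    β ^ Nat.card (Quotient (stateClasses G (extendState s o)))) = _
  rw [card_stateCircles_extendState, card_stateClasses_extendState, pow_add, pow_add]
  ring

end QState

/-! ### The linear system and the conclusion. -/

theorem det_system {R : Type*} [CommRing R] (α β : R) :
    ((α * β) • !![α * β, 1, 1, α; 1, α, 1, 1; 1, 1, α, 1; α, 1, 1, α]).det =
      (α * β) ^ 4 * (α * (β - 1) * (α - 1) ^ 2 * (α + 2)) := by
  rw [Matrix.det_smul, Fintype.card_fin]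
  congr 1
  simp [Matrix.det_succ_row_zero, Fin.sum_univ_succ, Fin.succAbove]
  ring

/-- The determinant vanishes only if `α` is `0`, `1` or `-2`, or `β` is `0` or `1`, so avoiding
integers is all that is needed for invertibility. -/
theorem AlgebraicIndependent.ne_intCast {ι K : Type*} [Field K] {x : ι → K}
    (h : AlgebraicIndependent ℤ x) (i : ι) (n : ℤ) : x i ≠ n := fun hn =>
  h.transcendental i (hn ▸ isAlgebraic_algebraMap (R := ℤ) (A := K) n)

theorem mainTheorem7 {P E P' E' : Type u} [Finite P] [Finite E] [Finite P'] [Finite E']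
    (G : VertexPartitioned P E) (H : VertexPartitioned P' E') (e : E') (φ : E → Coupling)
    {n : ℕ} (o : Fin n ≃ E)
    {K : Type*} [Field K] (a b c x α β : K)
    (hindep : AlgebraicIndependent ℤ ![a, b, c, x, α, β]) :
    ∃ ϕ : Fin 4 → K,
      (∀ ψ : Fin 4 → K,
        ((α * β) • !![α * β, 1, 1, α;
                      1,     α, 1, 1;
                      1,     1, α, 1;
                      α,     1, 1, α]).mulVec ψ =
            ![(H.delete e).Qhat a b c x α β,
              (H.contract e).Qhat a b c x α β,
              (H.penrose e).Qhat a b c x α β,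
              (H.mergeDelete e).Qhat a b c x α β] ↔ ψ = ϕ) ∧
      (tensor G H e φ o).pres.Qhat a b c x α β = G.Qhat (ϕ 0) (ϕ 1) (ϕ 2) (ϕ 3) α β := by
  set Φ := QState.typeSum H e (fun _ => ![a, b, c, x, 0]) α β with hΦ
  have hΦ4 : Φ 4 = 0 := QState.typeSum_four H e _ α β
  set A := (α * β) • !![α * β, 1, 1, α; 1, α, 1, 1; 1, 1, α, 1; α, 1, 1, α] with hA
  have hdet : IsUnit A.det := by
    have hα : ∀ n : ℤ, α ≠ n := hindep.ne_intCast 4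
    have hβ : ∀ n : ℤ, β ≠ n := hindep.ne_intCast 5
    have h0 : α ≠ 0 := by exact_mod_cast hα 0
    have h1 : α - 1 ≠ 0 := sub_ne_zero.2 (by exact_mod_cast hα 1)
    have h2 : α + 2 ≠ 0 := fun h => hα (-2) (by push_cast; exact eq_neg_of_add_eq_zero_left h)
    have h3 : β ≠ 0 := by exact_mod_cast hβ 0
    have h4 : β - 1 ≠ 0 := sub_ne_zero.2 (by exact_mod_cast hβ 1)
    rw [hA, det_system, isUnit_iff_ne_zero]
    positivity
  have hsol : A.mulVec ![Φ 0, Φ 1, Φ 2, Φ 3] =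
      ![(H.delete e).Qhat a b c x α β, (H.contract e).Qhat a b c x α β,
        (H.penrose e).Qhat a b c x α β, (H.mergeDelete e).Qhat a b c x α β] := by
    have h := fun o => QState.Qhat_op H e o a b c x α β
    -- The fifth type contributes nothing, which leaves a square system.
    simp only [← hΦ, Fin.sum_univ_five, hΦ4, mul_zero, add_zero] at h
    have h0 := h 0
    have h1 := h 1
    have h2 := h 2
    have h3 := h 3
    change (H.delete e).Qhat a b c x α β = _ at h0
    change (H.contract e).Qhat a b c x α β = _ at h1
    change (H.penrose e).Qhat a b c x α β = _ at h2
    change (H.mergeDelete e).Qhat a b c x α β = _ at h3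
    rw [h0, h1, h2, h3]
    funext i
    fin_cases i <;>
      simp [hA, Matrix.mulVec, dotProduct, Fin.sum_univ_four, QState.turn,
        -mul_eq_mul_left_iff, -mul_eq_mul_right_iff] <;> ring
  refine ⟨![Φ 0, Φ 1, Φ 2, Φ 3], fun ψ => ?_, ?_⟩
  · rw [← hsol]
    exact ⟨fun h => Matrix.mulVec_injective_of_isUnit ((Matrix.isUnit_iff_isUnit_det A).2 hdet) h,
      fun h => by rw [h]⟩
  -- Both sides are state sums over `G`; the weights agree by definition for the first four
  -- operations and through `Φ 4 = 0` for the fifth.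
  · rw [QState.Qhat_tensor, QState.Qhat_eq_weightedSum]
    congr! 2
    funext t
    fin_cases t
    exacts [rfl, rfl, rfl, rfl, hΦ4]
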